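/- Let $M$ be a compact smooth manifold without boundary, smoothly embedded in $\mathbb R^N$; $|\cdot|$ denotes Euclidean norms. Let $U\subset\mathbb R^m$ be nonempty and closed, let $f(x,u)\in T_xM$ ($x\in M$, $u\in U$) be continuous, and let $L:[0,\infty)\times M\times U\to\mathbb R$, $L=L(t,x,u)$, be continuous. Assume that there are constants $K_0,K_1$ and, for every $T>0$, a constant $\alpha_T$ such that for all $x,x_1,x_2\in M$, $u\in U$, $t\in[0,T]$: - $|f(x,u)|\le K_0(1+|x|+|u|)$; - $|f(x_2,u)-f(x_1,u)|\le K_1(1+|u|)\,|x_2-x_1|$ (in particular this holds if $f$ is Lipschitz in $x$ uniformly in $u$); - $L(t,x,u)/|u|\to\infty$ as $|u|\to\infty$ in $U$, uniformly in $x\in M$ and $t\in[0,T]$; - $|L(t,x_2,u)-L(t,x_1,u)|\le\alpha_T|x_2-x_1|$. For $\varphi_0\in C(M,\mathbb R)$, $t\ge0$ and $x\in M$ let $$V(t,x)=\inf_{(u,\gamma)}\Big\{\int_0^tL\big(s,\gamma(s),u(\gamma(s),s)\big)\,ds+\varphi_0(\gamma(0))\Big\},$$ where the infimum is over all feedback controls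 $u:M\times[0,t]\to U$ and absolutely continuous curves $\gamma:[0,t]\to M$ with $\dot\gamma(s)=f(\gamma(s),u(\gamma(s),s))$ for a.e. $s$ and $\gamma(t)=x$, such that $s\mapsto u(\gamma(s),s)$ is measurable and the running cost is integrable. Put $\mathcal T_t\varphi_0=V(t,\cdot)$. Then: 1. For every $\varphi_0\in C(M,\mathbb R)$, $V$ is continuous on $[0,\infty)\times M$ and is the unique continuous viscosity solution of $$V_t+H(t,x,V_x)=0\ \text{ on }(0,\infty)\times M,\qquad V(0,\cdot)=\varphi_0,\qquad H(t,x,p)=\sup_{u\in U}\big\{\langle p,f(x,u)\rangle-L(t,x,u)\big\}.$$ 2. For all $s,t\ge0$, $\mathcal T_{t+s}=\mathcal T^{(s)}_t\circ\mathcal T_s$ on $C(M,\mathbb R)$, where $\mathcal T^{(s)}_t$ is the operator $\mathcal T_t$ for the running cost $L(s+\cdot,\cdot,\cdot)$. 3. (Semigroup property.) If $L$ does not depend on $t$, so that the Hamiltonian is $H(x,p)$, then $\{\mathcal T_t\}_{t\ge0}$ is a one-parameter semigroup of operators $C(M,\mathbb R)\to C(M,\mathbb R)$: $\mathcal T_0=\mathrm{id}$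 and $\mathcal T_{t+s}=\mathcal T_t\circ\mathcal T_s$ for all $s,t\ge0$. -/

import Mathlib

open Set MeasureTheory Filter Topology
open scoped Manifold ContDiff NNReal

noncomputable section

/-- The data of a Bolza control problem on a manifold `M`: a control set `U ⊆ ℝᵐ`, a controlled
vector field `f(x, u) ∈ T_x M` and a running cost `L(t, x, u)`.  Only the values at `u ∈ U` and
`t ≥ 0` matter. -/
structure ControlProblem (n m : ℕ) (M : Type*) [TopologicalSpace M]
    [ChartedSpace (EuclideanSpace ℝ (Fin n)) M] where
  U : Set (EuclideanSpace ℝ (Fin m))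
  f : (x : M) → EuclideanSpace ℝ (Fin m) → TangentSpace 𝓘(ℝ, EuclideanSpace ℝ (Fin n)) x
  L : ℝ → M → EuclideanSpace ℝ (Fin m) → ℝ

namespace ControlProblem

variable {n m N : ℕ} {M : Type*} [TopologicalSpace M]
  [ChartedSpace (EuclideanSpace ℝ (Fin n)) M]

/-- The problem whose clock starts at time `r`: the running cost is `L(r + t, x, u)`. -/
def shift (P : ControlProblem n m M) (r : ℝ) : ControlProblem n m M where
  U := P.U
  f := P.f
  L := fun t x u => P.L (r + t) x u

/-- The vector `f(x, u)` seen in the ambient space `ℝᴺ` of the embedding `ι : M → ℝᴺ`. -/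
def ambient (P : ControlProblem n m M) (ι : M → EuclideanSpace ℝ (Fin N)) (x : M)
    (u : EuclideanSpace ℝ (Fin m)) : EuclideanSpace ℝ (Fin N) :=
  mfderiv 𝓘(ℝ, EuclideanSpace ℝ (Fin n)) 𝓘(ℝ, EuclideanSpace ℝ (Fin N)) ι x (P.f x u)

/-- The standing assumptions on the control system and the running cost, for a manifold embedded
in `ℝᴺ` by `ι`. -/
structure Regular (P : ControlProblem n m M) (ι : M → EuclideanSpace ℝ (Fin N)) : Prop where
  nonempty : P.U.Nonempty
  isClosed : IsClosed P.U
  continuous_f : ContinuousOn (fun z : M × EuclideanSpace ℝ (Fin m) => P.ambient ι z.1 z.2)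
    (univ ×ˢ P.U)
  continuous_L : ContinuousOn
    (fun z : ℝ × M × EuclideanSpace ℝ (Fin m) => P.L z.1 z.2.1 z.2.2)
    (Ici 0 ×ˢ univ ×ˢ P.U)
  /-- At most linear growth of `f`. -/
  growth_f : ∃ K₀ : ℝ, ∀ x, ∀ u ∈ P.U, ‖P.ambient ι x u‖ ≤ K₀ * (1 + ‖ι x‖ + ‖u‖)
  /-- `f` is Lipschitz in `x`.  The constant may grow linearly with `|u|`; this is implied by a
  Lipschitz bound uniform in `u`, and in contrast to it does not depend on the embedding. -/
  lipschitz_f : ∃ K₁ : ℝ, ∀ x₁ x₂, ∀ u ∈ P.U,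
    ‖P.ambient ι x₂ u - P.ambient ι x₁ u‖ ≤ K₁ * (1 + ‖u‖) * ‖ι x₂ - ι x₁‖
  /-- `L` is superlinear in the control: `L(t, x, u) / |u| → ∞` as `|u| → ∞`, uniformly in `x` and
  in `t` from a bounded interval. -/
  superlinear_L : ∀ T : ℝ, ∀ c : ℝ, ∃ R : ℝ, ∀ t ∈ Icc 0 T, ∀ x, ∀ u ∈ P.U,
    R ≤ ‖u‖ → c * ‖u‖ ≤ P.L t x u
  /-- `L` is Lipschitz in `x`, uniformly in the control and in `t` from a bounded interval. -/
  lipschitz_L : ∀ T : ℝ, ∃ α : ℝ, ∀ t ∈ Icc 0 T, ∀ x₁ x₂, ∀ u ∈ P.U,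
    |P.L t x₂ u - P.L t x₁ u| ≤ α * ‖ι x₂ - ι x₁‖

/-- `(u, γ)` is an admissible pair for the point `(t, x)`: `u(y, s) ∈ U` is a feedback control on
`M × [0, t]`, and `γ` is an absolutely continuous solution on `[0, t]` of
`γ' (s) = f(γ(s), u(γ(s), s))` for almost every `s`, with `γ(t) = x`, along which the control is
measurable and the running cost is integrable. -/
structure IsAdmissiblePair (P : ControlProblem n m M) (ι : M → EuclideanSpace ℝ (Fin N))
    (t : ℝ) (x : M) (u : M → ℝ → EuclideanSpace ℝ (Fin m)) (γ : ℝ → M) : Prop where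
  mem_U : ∀ y, ∀ s ∈ Icc 0 t, u y s ∈ P.U
  endpoint : γ t = x
  absolutelyContinuous : AbsolutelyContinuousOnInterval (fun s => ι (γ s)) 0 t
  measurable_control :
    AEStronglyMeasurable (fun s => u (γ s) s) (volume.restrict (Icc 0 t))
  equation : ∀ᵐ s ∂(volume.restrict (Icc 0 t)),
    HasDerivAt (fun r => ι (γ r)) (P.ambient ι (γ s) (u (γ s) s)) s
  integrable_cost : IntegrableOn (fun s => P.L s (γ s) (u (γ s) s)) (Icc 0 t)

/-- The Bolza cost `∫₀ᵗ L(s, γ(s), u(γ(s), s)) ds + φ(γ(0))`. -/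
def cost (P : ControlProblem n m M) (φ : M → ℝ) (t : ℝ) (u : M → ℝ → EuclideanSpace ℝ (Fin m))
    (γ : ℝ → M) : ℝ :=
  (∫ s in (0 : ℝ)..t, P.L s (γ s) (u (γ s) s)) + φ (γ 0)

/-- The value function `V(t, x)` of the Bolza problem with initial cost `φ`; the solution operator
at time `t` is `φ ↦ V(t, ·)`. -/
def value (P : ControlProblem n m M) (ι : M → EuclideanSpace ℝ (Fin N)) (φ : M → ℝ) (t : ℝ)
    (x : M) : ℝ :=
  sInf {c | ∃ u γ, P.IsAdmissiblePair ι t x u γ ∧ c = P.cost φ t u γ}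

/-- The Hamiltonian `H(t, x, p) = sup_{u ∈ U} (⟨p, f(x, u)⟩ - L(t, x, u))` for a covector `p`. -/
def hamiltonian (P : ControlProblem n m M) (t : ℝ) (x : M)
    (p : TangentSpace 𝓘(ℝ, EuclideanSpace ℝ (Fin n)) x →L[ℝ] ℝ) : ℝ :=
  sSup ((fun u => p (P.f x u) - P.L t x u) '' P.U)

/-- The left-hand side `ψ_t + H(t, x, ψ_x)` of the Hamilton-Jacobi equation for a test function. -/
def hjOperator (P : ControlProblem n m M) (ψ : ℝ → M → ℝ) (t : ℝ) (x : M) : ℝ :=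
  deriv (fun s => ψ s x) t +
    P.hamiltonian t x (mfderiv 𝓘(ℝ, EuclideanSpace ℝ (Fin n)) 𝓘(ℝ, ℝ) (ψ t) x)

/-- `W` is a (continuous) viscosity solution on `[0, ∞) × M` of the Cauchy problem
`W_t + H(t, x, W_x) = 0`, `W(0, ·) = φ`. -/
structure IsViscositySolution (P : ControlProblem n m M) (φ : M → ℝ) (W : ℝ → M → ℝ) : Prop where
  continuousOn : ContinuousOn (fun z : ℝ × M => W z.1 z.2) (Ici 0 ×ˢ univ)
  initial : ∀ x, W 0 x = φ x
  subsolution : ∀ ψ : ℝ → M → ℝ,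
    ContMDiff (𝓘(ℝ, ℝ).prod 𝓘(ℝ, EuclideanSpace ℝ (Fin n))) 𝓘(ℝ, ℝ) 1
      (fun z : ℝ × M => ψ z.1 z.2) →
    ∀ t₀ x₀, 0 < t₀ → IsLocalMax (fun z : ℝ × M => W z.1 z.2 - ψ z.1 z.2) (t₀, x₀) →
      P.hjOperator ψ t₀ x₀ ≤ 0
  supersolution : ∀ ψ : ℝ → M → ℝ,
    ContMDiff (𝓘(ℝ, ℝ).prod 𝓘(ℝ, EuclideanSpace ℝ (Fin n))) 𝓘(ℝ, ℝ) 1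
      (fun z : ℝ × M => ψ z.1 z.2) →
    ∀ t₀ x₀, 0 < t₀ → IsLocalMin (fun z : ℝ × M => W z.1 z.2 - ψ z.1 z.2) (t₀, x₀) →
      0 ≤ P.hjOperator ψ t₀ x₀

end ControlProblem

end

/-! Everything rests on dynamic programming: `V(b, x)` is the infimum of `∫_a^b L + V(a, γ(a))` over
trajectories on `[a, b]` ending at `x` (`value_le_integral_add_value`,
`exists_integral_add_value_le`). The composition law is this identity after a translation of time. A
feedback is only seen along its curve, so the infimum may be taken over open-loop controls
(`value_eq_sInf`). Superlinearity stands in for compactness of `U`: for every slope `c` one has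
`c‖u‖ - C ≤ L` (`exists_le_cost`), so almost optimal controls are bounded in `L¹`.

Trajectories on `M` are built in `ℝᴺ`. The field is extended by McShane's formula and the
Carathéodory equation is solved backwards from the endpoint. The squared distance to `M` then
satisfies a Gronwall inequality, because at a nearest point the field is tangent to `M` and hence
orthogonal to the residual. So the solution never leaves `M` (`exists_isSolution`).

For Lipschitz `φ` the value is Lipschitz in space, by running one control from two endpoints, and in
time, by dynamic programming. Since `φ ↦ V` is nonexpansive, continuity for every continuous `φ`
follows by uniform approximation. The subsolution property comes from differentiating along constant
controls. The supersolution property comes from almost optimal trajectories on short intervals, with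
estimates uniform in the unbounded control.

Uniqueness is by doubling of variables (`comparison`). The modulus of the Hamiltonian is uniform
over bounded momenta only, and the momentum of the penalty is bounded as soon as one of the two
functions is Lipschitz in space. An arbitrary solution is therefore squeezed between `V' - ε/2` and
`V' + ε/2`, where `V'` is the value for a Lipschitz datum close to `φ`. -/

/-! ### Absolutely continuous functions and backward Gronwall inequalities -/

theorem AbsolutelyContinuousOnInterval.of_dist_le {X Y : Type*} [PseudoMetricSpace X]
    [PseudoMetricSpace Y] {g : ℝ → X} {h : ℝ → Y} {a b C : ℝ}
    (hh : AbsolutelyContinuousOnInterval h a b)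
    (hd : ∀ s ∈ uIcc a b, ∀ t ∈ uIcc a b, dist (g s) (g t) ≤ C * dist (h s) (h t)) :
    AbsolutelyContinuousOnInterval g a b := by
  have h1 : Tendsto (fun E : ℕ × (ℕ → ℝ × ℝ) ↦
      C * ∑ i ∈ Finset.range E.1, dist (h (E.2 i).1) (h (E.2 i).2))
      (AbsolutelyContinuousOnInterval.totalLengthFilter ⊓
        𝓟 (AbsolutelyContinuousOnInterval.disjWithin a b)) (𝓝 0) := by
    simpa using Tendsto.const_mul C hh
  refine squeeze_zero' (.of_forall fun E => Finset.sum_nonneg fun _ _ => dist_nonneg) ?_ h1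
  filter_upwards [eventually_inf_principal.mpr (.of_forall fun E hE => hE)] with E hE
  rw [Finset.mul_sum]
  exact Finset.sum_le_sum fun i hi => hd _ (hE.1 i hi).1 _ (hE.1 i hi).2

theorem AbsolutelyContinuousOnInterval.exp {g : ℝ → ℝ} {a b : ℝ}
    (hg : AbsolutelyContinuousOnInterval g a b) :
    AbsolutelyContinuousOnInterval (fun s => Real.exp (g s)) a b := by
  obtain ⟨C, hC⟩ := hg.exists_bound
  refine hg.of_dist_le (C := Real.exp C) fun s hs t ht => ?_
  have hle : ∀ x ∈ Iic C, ‖deriv Real.exp x‖ ≤ Real.exp C := fun x hx => by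
    simpa using hx
  rw [dist_comm, dist_comm (g s), dist_eq_norm, dist_eq_norm]
  exact (convex_Iic C).norm_image_sub_le_of_norm_deriv_le
    (fun x _ => Real.differentiable_exp x) hle
    ((le_abs_self _).trans (hC s hs)) ((le_abs_self _).trans (hC t ht))

theorem AbsolutelyContinuousOnInterval.le_of_deriv_nonneg {g : ℝ → ℝ} {a b : ℝ} (hab : a ≤ b)
    (hg : AbsolutelyContinuousOnInterval g a b)
    (hd : ∀ᵐ s, s ∈ Icc a b → 0 ≤ deriv g s) : g a ≤ g b := by
  have := hg.integral_deriv_eq_sub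
  have h2 : 0 ≤ ∫ s in a..b, deriv g s := by
    refine intervalIntegral.integral_nonneg_of_ae_restrict hab ?_
    rwa [EventuallyLE, ae_restrict_iff' measurableSet_Icc]
  linarith

/-- Controlled curves are prescribed at their right end, so the primitives used throughout are
integrals up to `b`. -/
theorem IntervalIntegrable.absolutelyContinuousOnInterval_tail {E : Type*} [NormedAddCommGroup E]
    [NormedSpace ℝ E] {k : ℝ → E} {a b : ℝ} (hk : IntervalIntegrable k volume a b) :
    AbsolutelyContinuousOnInterval (fun s => ∫ r in s..b, k r) a b := by
  have := hk.norm.absolutelyContinuousOnInterval_intervalIntegral (c := b) right_mem_uIcc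
  refine this.of_dist_le (C := 1) fun s hs t ht => ?_
  have hst : ∀ s ∈ uIcc a b, IntervalIntegrable k volume s b := fun s hs =>
    hk.mono_set (uIcc_subset_uIcc_right hs)
  have e1 : ((∫ r in s..b, k r) - ∫ r in t..b, k r) = ∫ r in s..t, k r := by
    rw [← intervalIntegral.integral_add_adjacent_intervals ((hst s hs).trans (hst t ht).symm)
      (hst t ht)]
    abel
  have e2 : ((∫ r in b..s, ‖k r‖) - ∫ r in b..t, ‖k r‖) = ∫ r in t..s, ‖k r‖ := by
    rw [← intervalIntegral.integral_add_adjacent_intervals (hst t ht).symm.norm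
      ((hst t ht).trans (hst s hs).symm).norm]
    abel
  rw [dist_eq_norm, dist_eq_norm, e1, e2, intervalIntegral.integral_symm t s, norm_neg, one_mul,
    Real.norm_eq_abs]
  exact intervalIntegral.norm_integral_le_abs_integral_norm

theorem IntervalIntegrable.ae_hasDerivAt_tail {E : Type*} [NormedAddCommGroup E] [NormedSpace ℝ E]
    [CompleteSpace E] {k : ℝ → E} {a b : ℝ} (hk : IntervalIntegrable k volume a b) :
    ∀ᵐ s, s ∈ uIcc a b → HasDerivAt (fun s => ∫ r in s..b, k r) (-k s) s := by
  filter_upwards [hk.ae_hasDerivAt_integral] with s hs h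
  refine (hs h b right_mem_uIcc).neg.congr_of_eventuallyEq (.of_forall fun t => ?_)
  simp [← intervalIntegral.integral_symm]

/-- Backward Gronwall inequality for absolutely continuous functions. -/
theorem AbsolutelyContinuousOnInterval.le_mul_exp {g k : ℝ → ℝ} {a b : ℝ} (hab : a ≤ b)
    (hg : AbsolutelyContinuousOnInterval g a b) (hk : IntervalIntegrable k volume a b)
    (hd : ∀ᵐ s, s ∈ Icc a b → -(k s * g s) ≤ deriv g s) :
    g a ≤ g b * Real.exp (∫ r in a..b, k r) := by
  have hK := hk.absolutelyContinuousOnInterval_tail.neg.exp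
  -- Integrating factor: the derivative of `g s * exp (-∫ r in s..b, k r)` is `g' + k g` times a
  -- positive factor.
  have h1 := (hg.mul hK).le_of_deriv_nonneg hab ?_
  · simp only [Pi.mul_apply, Pi.neg_apply, intervalIntegral.integral_same, neg_zero,
      Real.exp_zero, mul_one] at h1
    calc g a = g a * Real.exp (-∫ r in a..b, k r) * Real.exp (∫ r in a..b, k r) := by
          rw [mul_assoc, ← Real.exp_add]; simp
      _ ≤ _ := by gcongr
  · filter_upwards [hk.ae_hasDerivAt_tail, hd, hg.ae_differentiableAt] with s h1 h2 h3 hs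
    rw [uIcc_of_le hab] at h1 h3
    have h4 := (h3 hs).hasDerivAt.mul (h1 hs).neg.exp
    have h5 : deriv (g * fun s => Real.exp ((-fun s => ∫ r in s..b, k r) s)) s = _ := h4.deriv
    rw [h5]
    have := h2 hs
    have e := Real.exp_pos ((-fun s => ∫ r in s..b, k r) s)
    nlinarith

/-- Backward Gronwall inequality in integral form. -/
theorem le_mul_exp_of_le_add_integral {g k : ℝ → ℝ} {a b c : ℝ} (hab : a ≤ b)
    (hg : ContinuousOn g (Icc a b)) (hk : IntervalIntegrable k volume a b)
    (hk0 : ∀ s ∈ Icc a b, 0 ≤ k s)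
    (h : ∀ t ∈ Icc a b, g t ≤ c + ∫ s in t..b, k s * g s) :
    g a ≤ c * Real.exp (∫ r in a..b, k r) := by
  have hkg : IntervalIntegrable (fun s => k s * g s) volume a b :=
    hk.mul_continuousOn (by rwa [uIcc_of_le hab])
  have hc : AbsolutelyContinuousOnInterval (fun _ : ℝ => c) a b :=
    (LipschitzWith.const (α := ℝ) c).lipschitzOnWith.absolutelyContinuousOnInterval
  -- The majorant `G t = c + ∫_t^b k g` is absolutely continuous although `g` is only continuous,
  -- and `G' = -k g ≥ -k G` because `k ≥ 0` and `g ≤ G`.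
  have hG := hc.add hkg.absolutelyContinuousOnInterval_tail
  have h1 := hG.le_mul_exp hab hk ?_
  · refine (h a (left_mem_Icc.2 hab)).trans ?_
    simpa using h1
  · filter_upwards [hkg.ae_hasDerivAt_tail] with s h1 hs
    rw [uIcc_of_le hab] at h1
    have h2 : deriv ((fun _ : ℝ => c) + fun s => ∫ r in s..b, k r * g r) s = _ :=
      ((hasDerivAt_const s c).add (h1 hs)).deriv
    rw [h2]
    have := mul_le_mul_of_nonneg_left (h s hs) (hk0 s hs)
    simp only [Pi.add_apply]
    linarith

/-- The integrand is minus the derivative of `exp (c ∫_s^b k)`. The case `c = 2` gives the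
contraction ratio of the weighted Picard operator. -/
theorem integral_mul_exp_tail {k : ℝ → ℝ} {a b c : ℝ}
    (hk : IntervalIntegrable k volume a b) :
    ∫ s in a..b, c * k s * Real.exp (c * ∫ r in s..b, k r) =
      Real.exp (c * ∫ r in a..b, k r) - 1 := by
  have h1 := (hk.absolutelyContinuousOnInterval_tail.const_mul c).exp.integral_deriv_eq_sub
  simp only [intervalIntegral.integral_same, mul_zero, Real.exp_zero] at h1
  rw [← neg_sub, ← h1, ← intervalIntegral.integral_neg]
  refine intervalIntegral.integral_congr_ae ?_
  filter_upwards [hk.ae_hasDerivAt_tail] with s h2 hs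
  rw [((h2 (uIoc_subset_uIcc hs)).const_mul c).exp.deriv]
  ring

/-! ### Carathéodory equations and invariance of compact sets -/

theorem intervalIntegrable_comp_of_lipschitz {E : Type*} [NormedAddCommGroup E]
    {a b C : ℝ} (hab : a ≤ b) {F : ℝ → E → E} {k : ℝ → ℝ} (hk : IntervalIntegrable k volume a b)
    (hF : ∀ s ∈ Icc a b, ∀ y z, ‖F s y - F s z‖ ≤ k s * ‖y - z‖)
    (hF0 : ∀ s ∈ Icc a b, ‖F s 0‖ ≤ C * k s)
    {y : ℝ → E} (hy : ContinuousOn y (Icc a b))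
    (hm : AEStronglyMeasurable (fun s => F s (y s)) (volume.restrict (Icc a b))) :
    IntervalIntegrable (fun s => F s (y s)) volume a b := by
  have h1 : IntervalIntegrable (fun s => k s * (C + ‖y s‖)) volume a b :=
    hk.mul_continuousOn (by rw [uIcc_of_le hab]; fun_prop)
  rw [intervalIntegrable_iff_integrableOn_Icc_of_le hab] at h1 ⊢
  refine h1.mono' hm ((ae_restrict_iff' measurableSet_Icc).2 (.of_forall fun s hs => ?_))
  have h2 := hF s hs (y s) 0
  have h3 := norm_le_norm_add_norm_sub' (F s (y s)) (F s 0)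
  rw [sub_zero] at h2
  linarith [hF0 s hs]

/-- Backward Carathéodory existence theorem for a vector field which is Lipschitz with an
integrable constant. -/
theorem exists_caratheodory_solution {E : Type*} [NormedAddCommGroup E] [NormedSpace ℝ E]
    [CompleteSpace E] {a b C : ℝ} (hab : a ≤ b) {F : ℝ → E → E} {k : ℝ → ℝ}
    (hk : IntervalIntegrable k volume a b) (hk0 : ∀ s ∈ Icc a b, 0 ≤ k s)
    (hF : ∀ s ∈ Icc a b, ∀ y z, ‖F s y - F s z‖ ≤ k s * ‖y - z‖)
    (hF0 : ∀ s ∈ Icc a b, ‖F s 0‖ ≤ C * k s)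
    (hm : ∀ y : ℝ → E, Continuous y →
      AEStronglyMeasurable (fun s => F s (y s)) (volume.restrict (Icc a b))) (x : E) :
    ∃ y : ℝ → E, Continuous y ∧ IntervalIntegrable (fun s => F s (y s)) volume a b ∧
      ∀ t ∈ Icc a b, y t = x - ∫ s in t..b, F s (y s) := by
  set K : ℝ → ℝ := fun s => ∫ r in s..b, k r with hK
  have hKc : ContinuousOn K (Icc a b) := by
    rw [← uIcc_of_le hab]; exact hk.absolutelyContinuousOnInterval_tail.continuousOn
  -- Bielecki's weight: with the unknown rescaled by `exp (2 K)`, the Picard operator contracts by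
  -- `1 / 2` on all of `[a, b]`, however large `∫ k` is, so no gluing of short intervals is needed.
  set y : C(Icc a b, E) → ℝ → E := fun z =>
    IccExtend hab fun s => Real.exp (2 * K s) • z s with hy
  have hyc : ∀ z, Continuous (y z) := fun z => by
    refine Continuous.Icc_extend' ?_
    have := continuousOn_iff_continuous_domRestrict.1 hKc
    have h2 : Continuous fun s : Icc a b => K s := this
    exact (Real.continuous_exp.comp (h2.const_mul 2)).smul z.continuous
  have hyi : ∀ z, IntervalIntegrable (fun s => F s (y z s)) volume a b := fun z =>
    intervalIntegrable_comp_of_lipschitz hab hk hF hF0 (hyc z).continuousOn (hm _ (hyc z))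
  have hsub : ∀ t ∈ Icc a b, uIcc t b ⊆ uIcc a b := fun t ht => by
    rw [uIcc_of_le hab, uIcc_of_le ht.2]; exact Icc_subset_Icc_left ht.1
  have htail : ∀ z, ContinuousOn (fun t => ∫ s in t..b, F s (y z s)) (Icc a b) := fun z => by
    have h1 := intervalIntegral.continuousOn_primitive_interval' (hyi z) (a := b) right_mem_uIcc
    rw [uIcc_of_le hab] at h1
    exact h1.neg.congr fun t _ => intervalIntegral.integral_symm _ _
  let Ψ : C(Icc a b, E) → C(Icc a b, E) := fun z =>
    ⟨fun t => Real.exp (-(2 * K t)) • (x - ∫ s in (t : ℝ)..b, F s (y z s)), by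
      have h1 := continuousOn_iff_continuous_domRestrict.1 hKc
      have h2 : Continuous fun s : Icc a b => K s := h1
      have h3 := continuousOn_iff_continuous_domRestrict.1 (htail z)
      have h4 : Continuous fun t : Icc a b => ∫ s in (t : ℝ)..b, F s (y z s) := h3
      exact (Real.continuous_exp.comp (h2.const_mul 2).neg).smul (continuous_const.sub h4)⟩
  have hΨ : ContractingWith (1 / 2) Ψ := by
    refine ⟨by norm_num, LipschitzWith.of_dist_le_mul fun z w => ?_⟩
    rw [ContinuousMap.dist_le (by positivity)]
    rintro ⟨t, ht⟩
    have hti : ∀ z, IntervalIntegrable (fun s => F s (y z s)) volume t b := fun z =>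
      (hyi z).mono_set (hsub t ht)
    have hkt : IntervalIntegrable k volume t b := hk.mono_set (hsub t ht)
    have hKt : ContinuousOn (fun s => Real.exp (2 * K s)) (uIcc t b) := by
      have := hKc.mono (by simpa [uIcc_of_le hab] using hsub t ht)
      fun_prop
    have h1 : ‖∫ s in t..b, (F s (y z s) - F s (y w s))‖ ≤
        ∫ s in t..b, (dist z w / 2) * (2 * k s * Real.exp (2 * K s)) := by
      refine intervalIntegral.norm_integral_le_of_norm_le ht.2 ?_
        (((hkt.const_mul 2).mul_continuousOn hKt).const_mul _)
      refine .of_forall fun s hs => ?_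
      have hs' : s ∈ Icc a b := ⟨ht.1.trans hs.1.le, hs.2⟩
      refine (hF s hs' _ _).trans ?_
      have h2 : ‖y z s - y w s‖ ≤ Real.exp (2 * K s) * dist z w := by
        simp only [hy, IccExtend_of_mem hab _ hs']
        rw [← smul_sub, norm_smul, Real.norm_eq_abs, Real.abs_exp, ← dist_eq_norm]
        gcongr
        exact ContinuousMap.dist_apply_le_dist _
      calc k s * ‖y z s - y w s‖ ≤ k s * (Real.exp (2 * K s) * dist z w) := by
            gcongr; exact hk0 s hs'
        _ = _ := by ring
    rw [intervalIntegral.integral_const_mul, integral_mul_exp_tail hkt] at h1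
    have h3 : dist (Ψ z ⟨t, ht⟩) (Ψ w ⟨t, ht⟩) = Real.exp (-(2 * K t)) *
        ‖∫ s in t..b, (F s (y z s) - F s (y w s))‖ := by
      rw [intervalIntegral.integral_sub (hti z) (hti w), dist_eq_norm]
      simp only [Ψ, ContinuousMap.coe_mk]
      rw [← smul_sub, norm_smul, Real.norm_eq_abs, Real.abs_exp, sub_sub_sub_cancel_left,
        norm_sub_rev]
    rw [h3]
    have h4 : Real.exp (-(2 * K t)) * Real.exp (2 * K t) = 1 := by rw [← Real.exp_add]; simp
    have h5 := Real.exp_pos (-(2 * K t))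
    calc _ ≤ Real.exp (-(2 * K t)) * (dist z w / 2 * (Real.exp (2 * K t) - 1)) := by
          gcongr
      _ = dist z w / 2 * (Real.exp (-(2 * K t)) * Real.exp (2 * K t) - Real.exp (-(2 * K t))) := by
          ring
      _ ≤ dist z w / 2 * 1 := by
          rw [h4]; have := dist_nonneg (x := z) (y := w); gcongr; linarith
      _ = _ := by push_cast; ring
  let z := ContractingWith.fixedPoint Ψ hΨ
  have hz : Ψ z = z := hΨ.fixedPoint_isFixedPt
  refine ⟨y z, hyc z, hyi z, fun t ht => ?_⟩
  have h1 : z ⟨t, ht⟩ = Real.exp (-(2 * K t)) • (x - ∫ s in t..b, F s (y z s)) := by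
    conv_lhs => rw [← hz]
    rfl
  conv_lhs => simp only [hy, IccExtend_of_mem hab _ ht]
  rw [h1, smul_smul, ← Real.exp_add]
  simp

/-- A solution of a Carathéodory equation which ends in a compact set stays in the compact set,
when the vector field is tangent to it. -/
theorem mem_of_forall_inner_eq_zero {E : Type*} [NormedAddCommGroup E] [InnerProductSpace ℝ E]
    [CompleteSpace E] {a b : ℝ} (hab : a ≤ b) {F : ℝ → E → E} {k : ℝ → ℝ}
    (hk : IntervalIntegrable k volume a b) (hF : ∀ s ∈ Icc a b, ∀ y z, ‖F s y - F s z‖ ≤ k s * ‖y - z‖) {S : Set E}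
    (hS : IsCompact S)
    (htan : ∀ s ∈ Icc a b, ∀ y, ∀ p ∈ S, (∀ q ∈ S, ‖y - p‖ ≤ ‖y - q‖) → inner ℝ (y - p) (F s p) = 0)
    {y : ℝ → E} {x : E} (hx : x ∈ S)
    (hi : IntervalIntegrable (fun s => F s (y s)) volume a b)
    (hy : ∀ t ∈ Icc a b, y t = x - ∫ s in t..b, F s (y s)) :
    y a ∈ S := by
  have hyac : AbsolutelyContinuousOnInterval y a b := by
    refine hi.absolutelyContinuousOnInterval_tail.of_dist_le (C := 1) fun s hs t ht => ?_
    rw [uIcc_of_le hab] at hs ht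
    rw [hy s hs, hy t ht, dist_sub_left, one_mul]
  have hne : S.Nonempty := ⟨x, hx⟩
  set d : ℝ → ℝ := fun s => Metric.infDist (y s) S with hd
  have hdac : AbsolutelyContinuousOnInterval d a b :=
    hyac.of_dist_le (C := 1) fun s _ t _ => by
      simpa using (Metric.lipschitz_infDist_pt S).dist_le_mul (y s) (y t)
  have h0 := (hdac.mul hdac).le_mul_exp hab (hk.const_mul 2) ?_
  · have hyb : y b = x := by simpa using hy b (right_mem_Icc.2 hab)
    have hdb : d b = 0 := by simp [hd, hyb, Metric.infDist_zero_of_mem hx]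
    simp only [Pi.mul_apply, hdb, zero_mul] at h0
    have hda : d a = 0 := by nlinarith
    exact (hS.isClosed.mem_iff_infDist_zero hne).2 hda
  · filter_upwards [hdac.ae_differentiableAt, hi.ae_hasDerivAt_tail,
      (Ioo_ae_eq_Icc (a := a) (b := b) (μ := volume)).mem_iff] with s h1 h2 h3 hs
    rw [uIcc_of_le hab] at h1 h2
    have hy' : HasDerivAt y (F s (y s)) s := by
      have h4 := (hasDerivAt_const s x).sub (h2 hs)
      rw [zero_sub, neg_neg] at h4
      refine h4.congr_of_eventuallyEq ?_
      filter_upwards [Icc_mem_nhds (h3.2 hs).1 (h3.2 hs).2] with t ht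
      exact hy t ht
    obtain ⟨p, hp, hdp⟩ := hS.exists_infDist_eq_dist hne (y s)
    have hpq : ∀ q ∈ S, ‖y s - p‖ ≤ ‖y s - q‖ := fun q hq => by
      rw [← dist_eq_norm, ← dist_eq_norm, ← hdp]; exact Metric.infDist_le_dist_of_mem hq
    -- The nearest point `p` is frozen at time `s`. The smooth function `‖y r - p‖²` lies above `d²`
    -- and agrees with it at `r = s`, so the two derivatives coincide there.
    have hmin : IsLocalMin (fun r => ‖y r - p‖ ^ 2 - (d * d) r) s := by
      refine .of_forall fun r => ?_
      have h5 : d s = ‖y s - p‖ := by rw [← dist_eq_norm]; exact hdp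
      have h6 : d r ≤ ‖y r - p‖ := by rw [← dist_eq_norm]; exact Metric.infDist_le_dist_of_mem hp
      have h7 : 0 ≤ d r := Metric.infDist_nonneg
      simp only [Pi.mul_apply, h5]
      nlinarith
    have hdd := (h1 hs).hasDerivAt.mul (h1 hs).hasDerivAt
    have h8 := hmin.hasDerivAt_eq_zero (((hy'.sub_const p).norm_sq).sub hdd)
    have h9 : deriv (d * d) s = _ := hdd.deriv
    rw [h9, ← sub_eq_zero.1 h8]
    -- Tangency at `p` allows `F s p` to be subtracted for free; the Lipschitz bound then gives
    -- `(d²)' ≥ -2 k d²`.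
    have h10 : inner ℝ (y s - p) (F s (y s)) = inner ℝ (y s - p) (F s (y s) - F s p) := by
      rw [inner_sub_right, htan s hs _ p hp hpq, sub_zero]
    have h11 := abs_real_inner_le_norm (y s - p) (F s (y s) - F s p)
    have h12 := hF s hs (y s) p
    have h13 : d s = ‖y s - p‖ := by rw [← dist_eq_norm]; exact hdp
    rw [h10]
    simp only [Pi.mul_apply, h13]
    have h14 := mul_le_mul_of_nonneg_left h12 (norm_nonneg (y s - p))
    have := neg_le_of_abs_le h11
    nlinarith

/-! ### Passage between the manifold and the ambient space -/

/-- In adapted charts an immersion is `x ↦ (x, 0)`, so dropping the second component inverts it. A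
local inverse suffices for test functions; no tubular neighbourhood is needed. -/
theorem Manifold.IsImmersionAt.exists_leftInverse {n N : ℕ} {M : Type*} [TopologicalSpace M]
    [ChartedSpace (EuclideanSpace ℝ (Fin n)) M]
    [IsManifold 𝓘(ℝ, EuclideanSpace ℝ (Fin n)) ∞ M]
    {ι : M → EuclideanSpace ℝ (Fin N)} {x₀ : M}
    (h : IsImmersionAt 𝓘(ℝ, EuclideanSpace ℝ (Fin n)) 𝓘(ℝ, EuclideanSpace ℝ (Fin N)) ∞ ι x₀) :
    ∃ ρ : EuclideanSpace ℝ (Fin N) → M,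
      ContMDiffAt 𝓘(ℝ, EuclideanSpace ℝ (Fin N)) 𝓘(ℝ, EuclideanSpace ℝ (Fin n)) ∞ ρ (ι x₀) ∧
        ∀ᶠ x in 𝓝 x₀, ρ (ι x) = x := by
  set φ := h.domChart.extend 𝓘(ℝ, EuclideanSpace ℝ (Fin n)) with hφ
  set χ := h.codChart.extend 𝓘(ℝ, EuclideanSpace ℝ (Fin N)) with hχ
  have hx₀ : x₀ ∈ φ.source := by simpa [hφ] using h.mem_domChart_source
  have key : ∀ x ∈ φ.source, χ (ι x) = h.equiv (φ x, 0) := fun x hx => by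
    have := h.writtenInCharts (φ.map_source hx)
    simp only [Function.comp_apply] at this
    rw [← hφ, φ.left_inv hx] at this
    exact this
  refine ⟨fun y => φ.symm (h.equiv.symm (χ y)).1, ?_, ?_⟩
  · have h1 : ContMDiffAt 𝓘(ℝ, EuclideanSpace ℝ (Fin N)) 𝓘(ℝ, EuclideanSpace ℝ (Fin N)) ∞ χ
        (ι x₀) := h.codChart.contMDiffAt_extend h.codChart_mem_maximalAtlas h.mem_codChart_source
    have h2 : ContMDiffAt 𝓘(ℝ, EuclideanSpace ℝ (Fin N)) 𝓘(ℝ, EuclideanSpace ℝ (Fin n)) ∞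
        (fun y => (h.equiv.symm y).1) (χ (ι x₀)) :=
      ((contDiff_fst.comp h.equiv.symm.contDiff).contMDiff).contMDiffAt
    have h3 : ContMDiffAt 𝓘(ℝ, EuclideanSpace ℝ (Fin n)) 𝓘(ℝ, EuclideanSpace ℝ (Fin n)) ∞ φ.symm
        (h.equiv.symm (χ (ι x₀))).1 := by
      have h4 : (h.equiv.symm (χ (ι x₀))).1 = φ x₀ := by simp [key x₀ hx₀]
      rw [h4]
      have h5 : φ.target ∈ 𝓝 (φ x₀) :=
        (h.domChart.isOpen_extend_target).mem_nhds (φ.map_source hx₀)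
      have h6 := contMDiffOn_extend_symm h.domChart_mem_maximalAtlas
      refine ContMDiffOn.contMDiffAt h6 ?_
      simpa [hφ] using h5
    exact ContMDiffAt.comp (ι x₀) (g := φ.symm) (f := fun y => (h.equiv.symm (χ y)).1) h3
      (h2.comp _ h1)
  · have h5 : φ.source ∈ 𝓝 x₀ := by
      rw [hφ, OpenPartialHomeomorph.extend_source]
      exact h.domChart.open_source.mem_nhds h.mem_domChart_source
    filter_upwards [h5] with x hx
    simp [key x hx, φ.left_inv hx]

theorem IsLocalMin.mfderiv_eq_zero {n : ℕ} {M : Type*} [TopologicalSpace M]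
    [ChartedSpace (EuclideanSpace ℝ (Fin n)) M] {g : M → ℝ} {x : M} (hg : IsLocalMin g x) :
    mfderiv 𝓘(ℝ, EuclideanSpace ℝ (Fin n)) 𝓘(ℝ, ℝ) g x = 0 := by
  by_cases h : MDifferentiableAt 𝓘(ℝ, EuclideanSpace ℝ (Fin n)) 𝓘(ℝ, ℝ) g x
  · rw [h.mfderiv]
    simp only [modelWithCornersSelf_coe, range_id, fderivWithin_univ]
    refine IsLocalMin.fderiv_eq_zero ?_
    have h1 := continuousAt_extChartAt_symm (I := 𝓘(ℝ, EuclideanSpace ℝ (Fin n))) x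
    have h2 : IsMinFilter g (𝓝 ((extChartAt 𝓘(ℝ, EuclideanSpace ℝ (Fin n)) x).symm
        (extChartAt 𝓘(ℝ, EuclideanSpace ℝ (Fin n)) x x)))
        ((extChartAt 𝓘(ℝ, EuclideanSpace ℝ (Fin n)) x).symm
        (extChartAt 𝓘(ℝ, EuclideanSpace ℝ (Fin n)) x x)) := by
      rw [extChartAt_to_inv]; exact hg
    exact h2.comp_tendsto h1
  · exact mfderiv_zero_of_not_mdifferentiableAt h

/-- First-order condition for the minimum of `z ↦ ‖y - ι z‖²` at `x`. It supplies the tangency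
hypothesis of `mem_of_forall_inner_eq_zero` for the set `range ι`. -/
theorem inner_mfderiv_eq_zero_of_forall_norm_le {n N : ℕ} {M : Type*} [TopologicalSpace M]
    [ChartedSpace (EuclideanSpace ℝ (Fin n)) M]
    {ι : M → EuclideanSpace ℝ (Fin N)} {x : M}
    (hι : MDifferentiableAt 𝓘(ℝ, EuclideanSpace ℝ (Fin n)) 𝓘(ℝ, EuclideanSpace ℝ (Fin N)) ι x)
    {y : EuclideanSpace ℝ (Fin N)} (hy : ∀ z, ‖y - ι x‖ ≤ ‖y - ι z‖)
    (w : TangentSpace 𝓘(ℝ, EuclideanSpace ℝ (Fin n)) x) :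
    inner ℝ (y - ι x)
      (mfderiv 𝓘(ℝ, EuclideanSpace ℝ (Fin n)) 𝓘(ℝ, EuclideanSpace ℝ (Fin N)) ι x w :
        EuclideanSpace ℝ (Fin N)) = 0 := by
  have hmin : IsLocalMin ((fun v => ‖y - v‖ ^ 2) ∘ ι) x :=
    .of_forall fun z => pow_le_pow_left₀ (norm_nonneg _) (hy z) 2
  have hd : HasFDerivAt (fun v : EuclideanSpace ℝ (Fin N) => ‖y - v‖ ^ 2)
      (2 • (innerSL ℝ (y - ι x)).comp (-ContinuousLinearMap.id ℝ _)) (ι x) := by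
    have := ((hasFDerivAt_id (𝕜 := ℝ) (ι x)).const_sub y).norm_sq
    exact this
  have h0 := hmin.mfderiv_eq_zero (n := n)
  rw [mfderiv_comp x hd.hasMFDerivAt.mdifferentiableAt hι, hd.hasMFDerivAt.mfderiv] at h0
  have h1 := congrArg (fun T : EuclideanSpace ℝ (Fin n) →L[ℝ] ℝ => T w) h0
  obtain ⟨v, hv⟩ : ∃ v : EuclideanSpace ℝ (Fin N), v = mfderiv 𝓘(ℝ, EuclideanSpace ℝ (Fin n))
    𝓘(ℝ, EuclideanSpace ℝ (Fin N)) ι x w := ⟨_, rfl⟩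
  have h2 : 2 • inner ℝ (y - ι x) (-v) = 0 := by rw [hv]; exact h1
  rw [inner_neg_right] at h2
  have h3 : inner ℝ (y - ι x) v = 0 := by simpa using h2
  rw [hv] at h3
  exact h3

/-- A `C¹` function on `ℝ × M` is locally the restriction of a differentiable function on the
ambient space. -/
theorem exists_ambient_extension {n N : ℕ} {M : Type*} [TopologicalSpace M]
    [ChartedSpace (EuclideanSpace ℝ (Fin n)) M]
    [IsManifold 𝓘(ℝ, EuclideanSpace ℝ (Fin n)) ∞ M]
    {ι : M → EuclideanSpace ℝ (Fin N)} {x₀ : M}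
    (h : Manifold.IsImmersionAt 𝓘(ℝ, EuclideanSpace ℝ (Fin n))
      𝓘(ℝ, EuclideanSpace ℝ (Fin N)) ∞ ι x₀)
    {ψ : ℝ → M → ℝ}
    (hψ : ContMDiff (𝓘(ℝ, ℝ).prod 𝓘(ℝ, EuclideanSpace ℝ (Fin n))) 𝓘(ℝ, ℝ) 1
      (fun z : ℝ × M => ψ z.1 z.2)) (t₀ : ℝ) :
    ∃ (Ψ : ℝ × EuclideanSpace ℝ (Fin N) → ℝ) (Ψ' : ℝ × EuclideanSpace ℝ (Fin N) →L[ℝ] ℝ),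
      HasFDerivAt Ψ Ψ' (t₀, ι x₀) ∧ (∀ᶠ x in 𝓝 x₀, ∀ t, Ψ (t, ι x) = ψ t x) ∧
      deriv (fun s => ψ s x₀) t₀ = Ψ' (1, 0) ∧
      ∀ w : TangentSpace 𝓘(ℝ, EuclideanSpace ℝ (Fin n)) x₀,
        mfderiv 𝓘(ℝ, EuclideanSpace ℝ (Fin n)) 𝓘(ℝ, ℝ) (ψ t₀) x₀ w =
        Ψ' (0, mfderiv 𝓘(ℝ, EuclideanSpace ℝ (Fin n)) 𝓘(ℝ, EuclideanSpace ℝ (Fin N)) ι x₀ w) := by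
  obtain ⟨ρ, hρ, hinv⟩ := h.exists_leftInverse
  set Ψ : ℝ × EuclideanSpace ℝ (Fin N) → ℝ := fun z => ψ z.1 (ρ z.2) with hΨ
  have hρ0 : ρ (ι x₀) = x₀ := hinv.self_of_nhds
  have hΨd : DifferentiableAt ℝ Ψ (t₀, ι x₀) := by
    rw [← mdifferentiableAt_iff_differentiableAt]
    have h1 : MDifferentiableAt 𝓘(ℝ, ℝ × EuclideanSpace ℝ (Fin N)) 𝓘(ℝ, ℝ) Prod.fst
        (t₀, ι x₀) := differentiableAt_fst.mdifferentiableAt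
    have h2 : MDifferentiableAt 𝓘(ℝ, ℝ × EuclideanSpace ℝ (Fin N))
        𝓘(ℝ, EuclideanSpace ℝ (Fin N)) Prod.snd (t₀, ι x₀) :=
      differentiableAt_snd.mdifferentiableAt
    have h3 : MDifferentiableAt 𝓘(ℝ, ℝ × EuclideanSpace ℝ (Fin N))
        𝓘(ℝ, EuclideanSpace ℝ (Fin n)) (ρ ∘ Prod.snd) (t₀, ι x₀) :=
      (hρ.mdifferentiableAt (by simp)).comp (t₀, ι x₀) h2
    exact (hψ.mdifferentiable one_ne_zero _).comp (t₀, ι x₀) (h1.prodMk h3)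
  have hev : ∀ᶠ x in 𝓝 x₀, ∀ t, Ψ (t, ι x) = ψ t x := by
    filter_upwards [hinv] with x hx t
    simp [hΨ, hx]
  refine ⟨Ψ, fderiv ℝ Ψ (t₀, ι x₀), hΨd.hasFDerivAt, hev, ?_, fun w => ?_⟩
  · have h1 : HasDerivAt (fun s : ℝ => (s, ι x₀)) (1, 0) t₀ :=
      (hasDerivAt_id t₀).prodMk (hasDerivAt_const _ _)
    have h2 := hΨd.hasFDerivAt.comp_hasDerivAt t₀ h1
    rw [← h2.deriv]
    congr 1
    ext s
    simp [hΨ, hρ0]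
  · have h1 : HasFDerivAt (fun v : EuclideanSpace ℝ (Fin N) => (t₀, v))
        (ContinuousLinearMap.inr ℝ ℝ _) (ι x₀) := hasFDerivAt_prodMk_right _ _
    have h2 := (hΨd.hasFDerivAt.comp (ι x₀) h1).hasMFDerivAt
    have h3 : MDifferentiableAt 𝓘(ℝ, EuclideanSpace ℝ (Fin n)) 𝓘(ℝ, EuclideanSpace ℝ (Fin N)) ι x₀ :=
      h.contMDiffAt.mdifferentiableAt (by simp)
    have h4 := (h2.comp x₀ h3.hasMFDerivAt).congr_of_eventuallyEq (f₁ := ψ t₀) (by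
      filter_upwards [hev] with x hx
      simp [hx])
    rw [h4.mfderiv]
    rfl

theorem EuclideanSpace.norm_le_sqrt_mul_of_forall_abs_le {N : ℕ} {v : EuclideanSpace ℝ (Fin N)}
    {c : ℝ} (hc : 0 ≤ c) (h : ∀ i, |v i| ≤ c) : ‖v‖ ≤ √N * c := by
  rw [EuclideanSpace.norm_eq]
  refine Real.sqrt_le_iff.2 ⟨by positivity, ?_⟩
  calc ∑ i, ‖v i‖ ^ 2 ≤ ∑ _i : Fin N, c ^ 2 :=
        Finset.sum_le_sum fun i _ => pow_le_pow_left₀ (norm_nonneg _) (h i) 2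
    _ = (√N * c) ^ 2 := by simp [mul_pow]

/-- McShane extension of a family of Lipschitz maps, jointly continuous in the parameter. -/
theorem exists_lipschitz_extension {M A : Type*} [TopologicalSpace M] [CompactSpace M]
    [Nonempty M] [TopologicalSpace A] {N N' : ℕ} {ι : M → EuclideanSpace ℝ (Fin N)}
    (hι : Continuous ι) {f : M → A → EuclideanSpace ℝ (Fin N')}
    (hf : Continuous fun z : M × A => f z.1 z.2) {κ : A → ℝ} (hκ : Continuous κ)
    (hκ0 : ∀ u, 0 ≤ κ u) (hL : ∀ x₁ x₂ u, ‖f x₂ u - f x₁ u‖ ≤ κ u * ‖ι x₂ - ι x₁‖) :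
    ∃ g : EuclideanSpace ℝ (Fin N) → A → EuclideanSpace ℝ (Fin N'),
      (Continuous fun z : EuclideanSpace ℝ (Fin N) × A => g z.1 z.2) ∧
      (∀ x u, g (ι x) u = f x u) ∧ ∀ u y z, ‖g y u - g z u‖ ≤ √N' * κ u * ‖y - z‖ := by
  -- McShane's formula is scalar, so it is applied to each coordinate, at the price of the factor
  -- `√N'`. Compactness of `M` makes the infimum over `p` jointly continuous in point and parameter.
  let q : Fin N' → EuclideanSpace ℝ (Fin N) × A → M → ℝ := fun i z p =>
    f p z.2 i + κ z.2 * ‖z.1 - ι p‖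
  have hq : ∀ i, Continuous fun w : (EuclideanSpace ℝ (Fin N) × A) × M => q i w.1 w.2 := fun i => by
    have h1 : Continuous fun w : (EuclideanSpace ℝ (Fin N) × A) × M => f w.2 w.1.2 :=
      hf.comp (f := fun w : (EuclideanSpace ℝ (Fin N) × A) × M => (w.2, w.1.2)) (by fun_prop)
    simp only [q]
    fun_prop
  have hqc : ∀ i z, Continuous (q i z) := fun i z =>
    (hq i).comp (f := fun p => (z, p)) (by fun_prop)
  have hbdd : ∀ i z, BddBelow (q i z '' univ) := fun i z =>
    (isCompact_univ.image (hqc i z)).bddBelow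
  have hne : ∀ i z, (q i z '' univ).Nonempty := fun i z => univ_nonempty.image _
  have hstep : ∀ i u y z, sInf (q i (y, u) '' univ) ≤ sInf (q i (z, u) '' univ) + κ u * ‖y - z‖ := by
    intro i u y z
    rw [← sub_le_iff_le_add]
    refine le_csInf (hne _ _) ?_
    rintro _ ⟨p, -, rfl⟩
    have h1 : sInf (q i (y, u) '' univ) ≤ q i (y, u) p := csInf_le (hbdd _ _) ⟨p, mem_univ _, rfl⟩
    have h2 : ‖y - ι p‖ ≤ ‖y - z‖ + ‖z - ι p‖ := norm_sub_le_norm_sub_add_norm_sub _ _ _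
    have h3 := mul_le_mul_of_nonneg_left h2 (hκ0 u)
    simp only [q] at h1 ⊢
    linarith
  refine ⟨fun y u => WithLp.toLp 2 fun i => sInf (q i (y, u) '' univ), ?_, fun x u => ?_,
    fun u y z => ?_⟩
  · refine (PiLp.continuous_toLp 2 _).comp (continuous_pi fun i => ?_)
    exact isCompact_univ.continuous_sInf (hq i)
  · ext i
    refine le_antisymm ((csInf_le (hbdd _ _) ⟨x, mem_univ _, rfl⟩).trans (by simp [q])) ?_
    refine le_csInf (hne _ _) ?_
    rintro _ ⟨p, -, rfl⟩
    have h1 := (PiLp.norm_apply_le (f x u - f p u) i).trans (hL p x u)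
    have h2 := (le_abs_self _).trans h1
    simp only [PiLp.sub_apply] at h2
    simp only [q]
    linarith
  · rw [mul_assoc]
    refine EuclideanSpace.norm_le_sqrt_mul_of_forall_abs_le (by have := hκ0 u; positivity) fun i => ?_
    simp only [PiLp.sub_apply]
    have h1 := hstep i u y z
    have h2 := hstep i u z y
    rw [norm_sub_rev] at h2
    exact abs_sub_le_iff.2 ⟨by linarith, by linarith⟩

/-! ### Coercivity of the cost and solvability of the control system -/

namespace ControlProblem

section
variable {n m N : ℕ} {M : Type*} [TopologicalSpace M]
  [ChartedSpace (EuclideanSpace ℝ (Fin n)) M]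
  {P : ControlProblem n m M} {ι : M → EuclideanSpace ℝ (Fin N)}

/-- `γ` solves the control system on `[a, b]` with the open-loop control `v`. -/
structure IsSolution (P : ControlProblem n m M) (ι : M → EuclideanSpace ℝ (Fin N)) (a b : ℝ)
    (v : ℝ → P.U) (γ : ℝ → M) : Prop where
  meas : AEStronglyMeasurable v (volume.restrict (Icc a b))
  control : IntervalIntegrable (fun s => ‖(v s : EuclideanSpace ℝ (Fin m))‖) volume a b
  speed : IntervalIntegrable (fun s => P.ambient ι (γ s) (v s)) volume a b
  eq : ∀ s ∈ Icc a b, ι (γ s) = ι (γ b) - ∫ r in s..b, P.ambient ι (γ r) (v r)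

/-- A solution of the control system on `[a, b]` along which the running cost is integrable. -/
structure IsTrajectory (P : ControlProblem n m M) (ι : M → EuclideanSpace ℝ (Fin N)) (a b : ℝ)
    (v : ℝ → P.U) (γ : ℝ → M) : Prop extends P.IsSolution ι a b v γ where
  cost : IntervalIntegrable (fun s => P.L s (γ s) (v s)) volume a b

namespace Regular

theorem continuous_ambient (hP : P.Regular ι) :
    Continuous fun z : M × P.U => P.ambient ι z.1 z.2 := by
  have := hP.continuous_f.comp_continuous (f := fun z : M × P.U => (z.1, (z.2 : EuclideanSpace ℝ (Fin m))))
    (by fun_prop) (fun z => ⟨mem_univ _, z.2.2⟩)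
  exact this

theorem continuous_cost (hP : P.Regular ι) :
    Continuous fun z : ℝ × M × P.U => P.L (max z.1 0) z.2.1 z.2.2 := by
  have := hP.continuous_L.comp_continuous
    (f := fun z : ℝ × M × P.U => (max z.1 0, z.2.1, (z.2.2 : EuclideanSpace ℝ (Fin m))))
    (by fun_prop) (fun z => ⟨mem_Ici.2 (le_max_right _ _), mem_univ _, z.2.2.2⟩)
  exact this

theorem exists_lipschitz_ambient (hP : P.Regular ι) :
    ∃ K, 0 ≤ K ∧ ∀ x₁ x₂, ∀ u ∈ P.U,
      ‖P.ambient ι x₂ u - P.ambient ι x₁ u‖ ≤ K * (1 + ‖u‖) * ‖ι x₂ - ι x₁‖ := by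
  obtain ⟨K, hK⟩ := hP.lipschitz_f
  refine ⟨|K|, abs_nonneg _, fun x₁ x₂ u hu => (hK x₁ x₂ u hu).trans ?_⟩
  gcongr
  exact le_abs_self _

theorem exists_lipschitz_cost (hP : P.Regular ι) (T : ℝ) :
    ∃ α, 0 ≤ α ∧ ∀ t ∈ Icc 0 T, ∀ x₁ x₂, ∀ u ∈ P.U,
      |P.L t x₂ u - P.L t x₁ u| ≤ α * ‖ι x₂ - ι x₁‖ := by
  obtain ⟨K, hK⟩ := hP.lipschitz_L T
  refine ⟨|K|, abs_nonneg _, fun t ht x₁ x₂ u hu => (hK t ht x₁ x₂ u hu).trans ?_⟩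
  gcongr
  exact le_abs_self _

theorem shift (hP : P.Regular ι) {r : ℝ} (hr : 0 ≤ r) : (P.shift r).Regular ι where
  nonempty := hP.nonempty
  isClosed := hP.isClosed
  continuous_f := hP.continuous_f
  continuous_L := by
    refine hP.continuous_L.comp
      (f := fun z : ℝ × M × EuclideanSpace ℝ (Fin m) => (r + z.1, z.2.1, z.2.2)) (by fun_prop) ?_
    rintro ⟨t, x, u⟩ ⟨ht, hx, hu⟩
    exact ⟨add_nonneg hr ht, hx, hu⟩
  growth_f := hP.growth_f
  lipschitz_f := hP.lipschitz_f
  superlinear_L := fun T c => by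
    obtain ⟨R, hR⟩ := hP.superlinear_L (r + T) c
    exact ⟨R, fun t ht => hR (r + t) ⟨add_nonneg hr ht.1, by linarith [ht.2]⟩⟩
  lipschitz_L := fun T => by
    obtain ⟨α, hα⟩ := hP.lipschitz_L (r + T)
    exact ⟨α, fun t ht => hα (r + t) ⟨add_nonneg hr ht.1, by linarith [ht.2]⟩⟩

variable [CompactSpace M]

/-- Superlinearity handles `‖u‖ ≥ R`; on the remaining compact set `L` is bounded below. The freedom
in the slope `c` is essential: later estimates choose it to absorb Lipschitz constants or to make
controls small in `L¹`. -/
theorem exists_le_cost (hP : P.Regular ι) (T c : ℝ) :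
    ∃ C, 0 ≤ C ∧ ∀ t ∈ Icc 0 T, ∀ x, ∀ u ∈ P.U, c * ‖u‖ - C ≤ P.L t x u := by
  obtain ⟨R, hR⟩ := hP.superlinear_L T c
  have hK : IsCompact ((Icc 0 T) ×ˢ (univ : Set M) ×ˢ (P.U ∩ Metric.closedBall 0 R)) :=
    isCompact_Icc.prod (isCompact_univ.prod ((isCompact_closedBall _ _).inter_left hP.isClosed))
  have hc : ContinuousOn (fun z : ℝ × M × EuclideanSpace ℝ (Fin m) =>
      c * ‖z.2.2‖ - P.L z.1 z.2.1 z.2.2) ((Icc 0 T) ×ˢ univ ×ˢ (P.U ∩ Metric.closedBall 0 R)) := by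
    refine ContinuousOn.sub (by fun_prop) (hP.continuous_L.mono ?_)
    rintro ⟨t, x, u⟩ ⟨ht, -, hu⟩
    exact ⟨ht.1, mem_univ _, hu.1⟩
  obtain ⟨C, hC⟩ := (hK.image_of_continuousOn hc).bddAbove
  refine ⟨max C 0, le_max_right _ _, fun t ht x u hu => ?_⟩
  rcases le_total R ‖u‖ with h | h
  · have := hR t ht x u hu h
    have := le_max_right C 0
    linarith
  · have := hC ⟨(t, x, u), ⟨ht, mem_univ _, hu, by simpa using h⟩, rfl⟩
    have := le_max_left C 0
    simp only at *
    linarith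

theorem exists_norm_ambient_le (hP : P.Regular ι) (hι : Continuous ι) :
    ∃ K, 0 ≤ K ∧ ∀ x, ∀ u ∈ P.U, ‖P.ambient ι x u‖ ≤ K * (1 + ‖u‖) := by
  obtain ⟨K₀, hK⟩ := hP.growth_f
  obtain ⟨B, hB⟩ := (isCompact_range hι.norm).bddAbove
  refine ⟨|K₀| * (1 + |B|), by positivity, fun x u hu => (hK x u hu).trans ?_⟩
  have h1 : ‖ι x‖ ≤ |B| := (hB ⟨x, rfl⟩).trans (le_abs_self _)
  have h2 := norm_nonneg u
  calc K₀ * (1 + ‖ι x‖ + ‖u‖) ≤ |K₀| * ((1 + |B|) * (1 + ‖u‖)) := by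
        refine mul_le_mul (le_abs_self _) ?_ (by positivity) (by positivity)
        nlinarith [abs_nonneg B]
    _ = _ := by ring

theorem exists_isSolution (hP : P.Regular ι)
    (hι : Manifold.IsSmoothEmbedding 𝓘(ℝ, EuclideanSpace ℝ (Fin n))
      𝓘(ℝ, EuclideanSpace ℝ (Fin N)) ∞ ι) {a b : ℝ} (hab : a ≤ b) {v : ℝ → P.U}
    (hv : AEStronglyMeasurable v (volume.restrict (Icc a b)))
    (hvi : IntervalIntegrable (fun s => ‖(v s : EuclideanSpace ℝ (Fin m))‖) volume a b) (x : M) :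
    ∃ γ, P.IsSolution ι a b v γ ∧ γ b = x := by
  have : Nonempty M := ⟨x⟩
  have hιc : Continuous ι := hι.isEmbedding.continuous
  obtain ⟨K, hK0, hK⟩ := hP.exists_norm_ambient_le hιc
  obtain ⟨κ, hκ0, hκ⟩ := hP.exists_lipschitz_ambient
  obtain ⟨g, hgc, hgf, hgL⟩ := exists_lipschitz_extension hιc hP.continuous_ambient
    (κ := fun u : P.U => κ * (1 + ‖(u : EuclideanSpace ℝ (Fin m))‖)) (by fun_prop)
    (fun u => by positivity) (fun x₁ x₂ u => hκ x₁ x₂ u u.2)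
  -- One integrable function dominating both the Lipschitz constant of the extension, `√N * κ * (1 +
  -- ‖v s‖)`, and the growth `K * (1 + ‖v s‖)` of the field.
  set k : ℝ → ℝ := fun s => (√N * κ + K) * (1 + ‖(v s : EuclideanSpace ℝ (Fin m))‖) with hk
  have hki : IntervalIntegrable k volume a b := (intervalIntegrable_const.add hvi).const_mul _
  have hF : ∀ s ∈ Icc a b, ∀ y z, ‖g y (v s) - g z (v s)‖ ≤ k s * ‖y - z‖ := fun s _ y z => by
    refine (hgL (v s) y z).trans ?_
    have : √N * (κ * (1 + ‖(v s : EuclideanSpace ℝ (Fin m))‖)) ≤ k s := by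
      simp only [hk]; rw [← mul_assoc]; gcongr; linarith
    gcongr
  have hF0 : ∀ s ∈ Icc a b, ‖g 0 (v s)‖ ≤ (1 + ‖ι x‖) * k s := fun s hs => by
    have h1 := hF s hs 0 (ι x)
    have h2 := norm_le_norm_add_norm_sub' (g 0 (v s)) (g (ι x) (v s))
    have h3 := hK x (v s) (v s).2
    rw [zero_sub, norm_neg] at h1
    rw [hgf] at h1 h2
    have h4 : K * (1 + ‖(v s : EuclideanSpace ℝ (Fin m))‖) ≤ k s := by
      have : 0 ≤ √N * κ := by positivity
      simp only [hk]; gcongr; linarith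
    linarith
  obtain ⟨y, hyc, hyi, hy⟩ := exists_caratheodory_solution hab hki
    (fun s _ => by positivity) hF hF0 (fun y hy =>
      hgc.comp_aestronglyMeasurable (f := fun s => (y s, v s))
        (hy.aestronglyMeasurable.prodMk hv)) (ι x)
  have hmem : ∀ t ∈ Icc a b, y t ∈ range ι := fun t ht => by
    have hsub : uIcc t b ⊆ uIcc a b := by
      rw [uIcc_of_le hab, uIcc_of_le ht.2]; exact Icc_subset_Icc_left ht.1
    -- On `M` the extension is the original field, a value of the differential of `ι`; this is where
    -- `f(x, u) ∈ T_x M` keeps the solution on `M`.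
    refine mem_of_forall_inner_eq_zero ht.2 (hki.mono_set hsub)
      (fun s hs => hF s ⟨ht.1.trans hs.1, hs.2⟩) (isCompact_range hιc) ?_ (mem_range_self x)
      (hyi.mono_set hsub) (fun s hs => hy s ⟨ht.1.trans hs.1, hs.2⟩)
    rintro s - w _ ⟨p, rfl⟩ hp
    rw [hgf]
    exact inner_mfderiv_eq_zero_of_forall_norm_le
      (hι.contMDiff.contMDiffAt.mdifferentiableAt (by simp)) (fun z => hp _ ⟨z, rfl⟩) _
  choose! γ hγ using hmem
  have hb : b ∈ Icc a b := right_mem_Icc.2 hab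
  have hyb : y b = ι x := by simpa using hy b hb
  have hγg : ∀ s ∈ Icc a b, g (y s) (v s) = P.ambient ι (γ s) (v s) := fun s hs => by
    rw [← hγ s hs, hgf]
  have hsp : IntervalIntegrable (fun s => P.ambient ι (γ s) (v s)) volume a b := by
    refine hyi.congr fun s hs => hγg s ?_
    rw [uIoc_of_le hab] at hs
    exact Ioc_subset_Icc_self hs
  refine ⟨γ, ⟨hv, hvi, hsp, fun s hs => ?_⟩, hι.isEmbedding.injective ((hγ b hb).trans hyb)⟩
  rw [hγ s hs, hγ b hb, hyb, hy s hs]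
  congr 1
  refine intervalIntegral.integral_congr fun r hr => hγg r ?_
  rw [uIcc_of_le hs.2] at hr
  exact ⟨hs.1.trans hr.1, hr.2⟩

end Regular
end
end ControlProblem

/-! ### Restriction, concatenation, stability and time shift of trajectories -/

namespace ControlProblem

section
variable {n m N : ℕ} {M : Type*} [TopologicalSpace M]
  [ChartedSpace (EuclideanSpace ℝ (Fin n)) M]
  {P : ControlProblem n m M} {ι : M → EuclideanSpace ℝ (Fin N)} {a b c : ℝ} {v w : ℝ → P.U}
  {γ δ : ℝ → M}

namespace IsSolution

theorem continuousOn_ambient (h : P.IsSolution ι a b v γ) (hab : a ≤ b) :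
    ContinuousOn (fun s => ι (γ s)) (Icc a b) := by
  have h1 := h.speed.absolutelyContinuousOnInterval_tail.continuousOn
  rw [uIcc_of_le hab] at h1
  exact (continuousOn_const.sub h1).congr h.eq

theorem continuousOn (h : P.IsSolution ι a b v γ) (hι : Topology.IsEmbedding ι) (hab : a ≤ b) :
    ContinuousOn γ (Icc a b) :=
  hι.continuousOn_iff.2 (h.continuousOn_ambient hab)

theorem mono_left (h : P.IsSolution ι a c v γ) (hab : a ≤ b) (hbc : b ≤ c) :
    P.IsSolution ι a b v γ := by
  have hs : uIcc a b ⊆ uIcc a c := by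
    rw [uIcc_of_le hab, uIcc_of_le (hab.trans hbc)]; exact Icc_subset_Icc_right hbc
  have hs' : uIcc b c ⊆ uIcc a c := by
    rw [uIcc_of_le hbc, uIcc_of_le (hab.trans hbc)]; exact Icc_subset_Icc_left hab
  refine ⟨h.meas.mono_set (Icc_subset_Icc_right hbc), h.control.mono_set hs, h.speed.mono_set hs,
    fun s hs => ?_⟩
  have h1 : IntervalIntegrable (fun s => P.ambient ι (γ s) (v s)) volume s b :=
    h.speed.mono_set (by
      rw [uIcc_of_le hs.2, uIcc_of_le (hab.trans hbc)]; exact Icc_subset_Icc hs.1 hbc)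
  rw [h.eq s ⟨hs.1, hs.2.trans hbc⟩, h.eq b ⟨hab, hbc⟩,
    ← intervalIntegral.integral_add_adjacent_intervals h1 (h.speed.mono_set hs')]
  abel

theorem mono_right (h : P.IsSolution ι a c v γ) (hab : a ≤ b) (hbc : b ≤ c) :
    P.IsSolution ι b c v γ := by
  have hs : uIcc b c ⊆ uIcc a c := by
    rw [uIcc_of_le hbc, uIcc_of_le (hab.trans hbc)]; exact Icc_subset_Icc_left hab
  exact ⟨h.meas.mono_set (Icc_subset_Icc_left hab), h.control.mono_set hs, h.speed.mono_set hs,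
    fun s hs => h.eq s ⟨hab.trans hs.1, hs.2⟩⟩

/-- A single point is null, so the controls may differ at the left endpoint. This makes the value of
a concatenated control at the junction irrelevant. -/
theorem congr (h : P.IsSolution ι a b v γ) (hab : a ≤ b) (hv : ∀ s ∈ Ioc a b, w s = v s)
    (hγ : ∀ s ∈ Icc a b, δ s = γ s) : P.IsSolution ι a b w δ := by
  have hvw : ∀ s ∈ uIoc a b, w s = v s := by rwa [uIoc_of_le hab]
  have hγδ : ∀ s ∈ uIoc a b, δ s = γ s := by
    rw [uIoc_of_le hab]; exact fun s hs => hγ s (Ioc_subset_Icc_self hs)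
  refine ⟨?_, h.control.congr fun s hs => by rw [hvw s hs],
    h.speed.congr fun s hs => by rw [hvw s hs, hγδ s hs], fun s hs => ?_⟩
  · refine h.meas.congr ?_
    rw [EventuallyEq, ← restrict_Ioc_eq_restrict_Icc, ae_restrict_iff' measurableSet_Ioc]
    exact .of_forall fun s hs => (hv s hs).symm
  · rw [hγ s hs, hγ b (right_mem_Icc.2 hab), h.eq s hs]
    congr 1
    refine intervalIntegral.integral_congr_ae (.of_forall fun r hr => ?_)
    rw [uIoc_of_le hs.2] at hr
    rw [hv r ⟨hs.1.trans_lt hr.1, hr.2⟩, hγ r ⟨hs.1.trans hr.1.le, hr.2⟩]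

theorem concat (h₁ : P.IsSolution ι a b v γ) (h₂ : P.IsSolution ι b c v γ) (hab : a ≤ b)
    (hbc : b ≤ c) : P.IsSolution ι a c v γ := by
  refine ⟨?_, h₁.control.trans h₂.control, h₁.speed.trans h₂.speed, fun s hs => ?_⟩
  · rw [← Icc_union_Icc_eq_Icc hab hbc]
    exact aestronglyMeasurable_union_iff.2 ⟨h₁.meas, h₂.meas⟩
  · rcases le_total s b with hsb | hsb
    · have h1 : IntervalIntegrable (fun s => P.ambient ι (γ s) (v s)) volume s b :=
        h₁.speed.mono_set (by
          rw [uIcc_of_le hsb, uIcc_of_le hab]; exact Icc_subset_Icc_left hs.1)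
      rw [h₁.eq s ⟨hs.1, hsb⟩, h₂.eq b (left_mem_Icc.2 hbc),
        ← intervalIntegral.integral_add_adjacent_intervals h1 h₂.speed]
      abel
    · exact h₂.eq s ⟨hsb, hs.2⟩

/-- Gronwall for two solutions with the same control. The exponent involves only the `L¹` norm of
the control, the one norm that the cost controls. -/
theorem dist_le_mul_exp (h₁ : P.IsSolution ι a b v γ)
    (h₂ : P.IsSolution ι a b v δ) (hab : a ≤ b) {K : ℝ} (hK0 : 0 ≤ K)
    (hK : ∀ x₁ x₂, ∀ u ∈ P.U,
      ‖P.ambient ι x₂ u - P.ambient ι x₁ u‖ ≤ K * (1 + ‖u‖) * ‖ι x₂ - ι x₁‖) :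
    ‖ι (γ a) - ι (δ a)‖ ≤ ‖ι (γ b) - ι (δ b)‖ *
      Real.exp (∫ s in a..b, K * (1 + ‖(v s : EuclideanSpace ℝ (Fin m))‖)) := by
  have hki : IntervalIntegrable (fun s => K * (1 + ‖(v s : EuclideanSpace ℝ (Fin m))‖))
    volume a b := (intervalIntegrable_const.add h₁.control).const_mul _
  have hcont := (h₁.continuousOn_ambient hab).sub (h₂.continuousOn_ambient hab)
  refine le_mul_exp_of_le_add_integral (g := fun s => ‖ι (γ s) - ι (δ s)‖) hab hcont.norm
    hki (fun s _ => by positivity) fun t ht => ?_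
  have hsub : uIcc t b ⊆ uIcc a b := by
    rw [uIcc_of_le hab, uIcc_of_le ht.2]; exact Icc_subset_Icc_left ht.1
  have e1 : ι (γ t) - ι (δ t) = (ι (γ b) - ι (δ b)) -
      ∫ s in t..b, (P.ambient ι (γ s) (v s) - P.ambient ι (δ s) (v s)) := by
    rw [h₁.eq t ht, h₂.eq t ht, intervalIntegral.integral_sub (h₁.speed.mono_set hsub)
      (h₂.speed.mono_set hsub)]
    abel
  rw [e1]
  refine (norm_sub_le _ _).trans (add_le_add_right ?_ _)
  refine intervalIntegral.norm_integral_le_of_norm_le ht.2 ?_ ?_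
  · exact .of_forall fun s _ => hK _ _ _ (v s).2
  · refine (hki.mono_set hsub).mul_continuousOn ?_
    rw [uIcc_of_le ht.2]
    exact hcont.norm.mono (Icc_subset_Icc_left ht.1)

end IsSolution

namespace IsTrajectory

theorem mono_left (h : P.IsTrajectory ι a c v γ) (hab : a ≤ b) (hbc : b ≤ c) :
    P.IsTrajectory ι a b v γ :=
  ⟨h.toIsSolution.mono_left hab hbc, h.cost.mono_set (by
    rw [uIcc_of_le hab, uIcc_of_le (hab.trans hbc)]; exact Icc_subset_Icc_right hbc)⟩

theorem mono_right (h : P.IsTrajectory ι a c v γ) (hab : a ≤ b) (hbc : b ≤ c) :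
    P.IsTrajectory ι b c v γ :=
  ⟨h.toIsSolution.mono_right hab hbc, h.cost.mono_set (by
    rw [uIcc_of_le hbc, uIcc_of_le (hab.trans hbc)]; exact Icc_subset_Icc_left hab)⟩

theorem congr (h : P.IsTrajectory ι a b v γ) (hab : a ≤ b) (hv : ∀ s ∈ Ioc a b, w s = v s)
    (hγ : ∀ s ∈ Icc a b, δ s = γ s) : P.IsTrajectory ι a b w δ := by
  refine ⟨h.toIsSolution.congr hab hv hγ, h.cost.congr fun s hs => ?_⟩
  rw [uIoc_of_le hab] at hs
  rw [hv s hs, hγ s (Ioc_subset_Icc_self hs)]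

/-- Two trajectories which meet can be concatenated. -/
theorem exists_concat (h₁ : P.IsTrajectory ι a b v γ) (h₂ : P.IsTrajectory ι b c w δ)
    (hab : a ≤ b) (hbc : b ≤ c) (hb : γ b = δ b) :
    ∃ v' γ', P.IsTrajectory ι a c v' γ' ∧ γ' a = γ a ∧ γ' c = δ c ∧
      ∫ s in a..c, P.L s (γ' s) (v' s) =
        (∫ s in a..b, P.L s (γ s) (v s)) + ∫ s in b..c, P.L s (δ s) (w s) := by
  set v' : ℝ → P.U := fun s => if s ≤ b then v s else w s with hv'
  set γ' : ℝ → M := fun s => if s ≤ b then γ s else δ s with hγ'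
  have hv1 : ∀ s ∈ Ioc a b, v' s = v s := fun s hs => if_pos hs.2
  have hγ1 : ∀ s ∈ Icc a b, γ' s = γ s := fun s hs => if_pos hs.2
  have hv2 : ∀ s ∈ Ioc b c, v' s = w s := fun s hs => if_neg hs.1.not_ge
  have hγ2 : ∀ s ∈ Icc b c, γ' s = δ s := fun s hs => by
    rcases hs.1.eq_or_lt with h | h
    · rw [← h, hγ']; simp [hb]
    · exact if_neg h.not_ge
  have h1 := h₁.congr hab hv1 hγ1
  have h2 := h₂.congr hbc hv2 hγ2
  refine ⟨v', γ', ⟨h1.toIsSolution.concat h2.toIsSolution hab hbc, h1.cost.trans h2.cost⟩,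
    hγ1 a (left_mem_Icc.2 hab), hγ2 c (right_mem_Icc.2 hbc), ?_⟩
  rw [← intervalIntegral.integral_add_adjacent_intervals h1.cost h2.cost]
  congr 1
  · refine intervalIntegral.integral_congr_ae (.of_forall fun s hs => ?_)
    rw [uIoc_of_le hab] at hs
    rw [hv1 s hs, hγ1 s (Ioc_subset_Icc_self hs)]
  · refine intervalIntegral.integral_congr_ae (.of_forall fun s hs => ?_)
    rw [uIoc_of_le hbc] at hs
    rw [hv2 s hs, hγ2 s (Ioc_subset_Icc_self hs)]

theorem of_shift {r : ℝ} {v : ℝ → (P.shift r).U} (h : (P.shift r).IsTrajectory ι a b v γ) :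
    P.IsTrajectory ι (r + a) (r + b) (fun s => v (s - r)) (fun s => γ (s - r)) where
  meas := by
    have h1 := h.meas.comp_measurePreserving
      ((measurePreserving_sub_right volume r).restrict_preimage measurableSet_Icc)
    rw [preimage_sub_const_Icc, add_comm a, add_comm b] at h1
    exact h1
  control := by
    have h1 := h.control.comp_sub_right r
    rw [add_comm a, add_comm b] at h1
    exact h1
  speed := by
    have h1 := h.speed.comp_sub_right r
    rw [add_comm a, add_comm b] at h1
    exact h1
  cost := by
    have h1 := h.cost.comp_sub_right r
    rw [add_comm a, add_comm b] at h1
    refine h1.congr fun s _ => ?_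
    simp [shift]
  eq := fun s hs => by
    have h1 := h.eq (s - r) ⟨by linarith [hs.1], by linarith [hs.2]⟩
    rw [intervalIntegral.integral_comp_sub_right (fun s => P.ambient ι (γ s) (v s)) r]
    rw [add_sub_cancel_left]
    exact h1

theorem shift {r : ℝ} (h : P.IsTrajectory ι (r + a) (r + b) v γ) :
    (P.shift r).IsTrajectory ι a b (fun s => v (s + r)) (fun s => γ (s + r)) where
  meas := by
    have h1 := h.meas.comp_measurePreserving
      ((measurePreserving_add_right volume r).restrict_preimage measurableSet_Icc)
    rw [preimage_add_const_Icc, add_sub_cancel_left, add_sub_cancel_left] at h1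
    exact h1
  control := by
    have h1 := h.control.comp_add_right r
    rw [add_sub_cancel_left, add_sub_cancel_left] at h1
    exact h1
  speed := by
    have h1 := h.speed.comp_add_right r
    rw [add_sub_cancel_left, add_sub_cancel_left] at h1
    exact h1
  cost := by
    have h1 := h.cost.comp_add_right r
    rw [add_sub_cancel_left, add_sub_cancel_left] at h1
    refine h1.congr fun s _ => ?_
    simp [ControlProblem.shift, add_comm]
  eq := fun s hs => by
    have h1 := h.eq (s + r) ⟨by linarith [hs.1], by linarith [hs.2]⟩
    have h2 := intervalIntegral.integral_comp_add_right (a := s) (b := b)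
      (fun s => P.ambient ι (γ s) (v s)) r
    rw [add_comm r b] at h1
    rw [h1, ← h2]
    rfl

end IsTrajectory

/-- The running cost of the shifted problem, by translation in time. -/
theorem integral_shift {r t : ℝ} (v : ℝ → P.U) (γ : ℝ → M) :
    ∫ s in (0 : ℝ)..t, (P.shift r).L s (γ (s + r)) (v (s + r)) =
      ∫ s in r..r + t, P.L s (γ s) (v s) := by
  have h2 := intervalIntegral.integral_comp_add_right (a := 0) (b := t)
    (fun s => P.L s (γ s) (v s)) r
  rw [zero_add, add_comm t] at h2
  rw [← h2]
  simp only [shift, add_comm]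

end
end ControlProblem

/-! ### Open-loop form of the value function and dynamic programming -/

namespace ControlProblem

section
variable {n m N : ℕ} {M : Type*} [TopologicalSpace M]
  [ChartedSpace (EuclideanSpace ℝ (Fin n)) M]
  {P : ControlProblem n m M} {ι : M → EuclideanSpace ℝ (Fin N)} {a b c t : ℝ} {v w : ℝ → P.U}
  {γ δ : ℝ → M} {φ : M → ℝ} {x : M}

/-- Along a continuous curve and a measurable control the data of the problem are measurable. -/
theorem Regular.aestronglyMeasurable_comp (hP : P.Regular ι) (ha : 0 ≤ a)
    (hv : AEStronglyMeasurable v (volume.restrict (Icc a b))) (hγ : ContinuousOn γ (Icc a b))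
    (hι : Topology.IsEmbedding ι) :
    AEStronglyMeasurable (fun s => P.ambient ι (γ s) (v s)) (volume.restrict (Icc a b)) ∧
    AEStronglyMeasurable (fun s => P.L s (γ s) (v s)) (volume.restrict (Icc a b)) := by
  have : TopologicalSpace.MetrizableSpace M := hι.metrizableSpace
  have : SecondCountableTopology M := hι.secondCountableTopology
  have hγm : AEStronglyMeasurable γ (volume.restrict (Icc a b)) :=
    hγ.aestronglyMeasurable measurableSet_Icc
  refine ⟨hP.continuous_ambient.comp_aestronglyMeasurable (hγm.prodMk hv), ?_⟩
  refine (hP.continuous_cost.comp_aestronglyMeasurable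
    (aestronglyMeasurable_id.prodMk (hγm.prodMk hv))).congr ?_
  rw [EventuallyEq, ae_restrict_iff' measurableSet_Icc]
  refine .of_forall fun s hs => ?_
  simp [max_eq_left (ha.trans hs.1)]

/-- Integrated coercivity: a bound on the cost becomes an `L¹` bound on the control. With `k = 0` it
is just a lower bound for the cost. -/
theorem IsTrajectory.le_integral_cost {T k C : ℝ} (h : P.IsTrajectory ι a b v γ)
    (hC : ∀ t ∈ Icc 0 T, ∀ x, ∀ u ∈ P.U, k * ‖u‖ - C ≤ P.L t x u) (ha : 0 ≤ a) (hab : a ≤ b)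
    (hbT : b ≤ T) :
    k * (∫ s in a..b, ‖(v s : EuclideanSpace ℝ (Fin m))‖) - C * (b - a) ≤
      ∫ s in a..b, P.L s (γ s) (v s) := by
  have h1 : ∫ s in a..b, (k * ‖(v s : EuclideanSpace ℝ (Fin m))‖ - C) =
      k * (∫ s in a..b, ‖(v s : EuclideanSpace ℝ (Fin m))‖) - C * (b - a) := by
    rw [intervalIntegral.integral_sub (h.control.const_mul k) intervalIntegrable_const]
    simp [mul_comm]
  rw [← h1]
  exact intervalIntegral.integral_mono_on hab ((h.control.const_mul k).sub intervalIntegrable_const)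
    h.cost fun s hs => hC s ⟨ha.trans hs.1, hs.2.trans hbT⟩ _ _ (v s).2

theorem IsSolution.norm_displacement_le {K : ℝ} (h : P.IsSolution ι a b v γ)
    (hK : ∀ x, ∀ u ∈ P.U, ‖P.ambient ι x u‖ ≤ K * (1 + ‖u‖)) (hab : a ≤ b) :
    ‖ι (γ b) - ι (γ a)‖ ≤ K * ((b - a) + ∫ s in a..b, ‖(v s : EuclideanSpace ℝ (Fin m))‖) := by
  rw [h.eq a (left_mem_Icc.2 hab), sub_sub_cancel]
  have h1 : ∫ s in a..b, K * (1 + ‖(v s : EuclideanSpace ℝ (Fin m))‖) =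
      K * ((b - a) + ∫ s in a..b, ‖(v s : EuclideanSpace ℝ (Fin m))‖) := by
    rw [intervalIntegral.integral_const_mul,
      intervalIntegral.integral_add intervalIntegrable_const h.control]
    simp
  rw [← h1]
  exact intervalIntegral.norm_integral_le_of_norm_le hab (.of_forall fun s _ => hK _ _ (v s).2)
    ((intervalIntegrable_const.add h.control).const_mul _)

/-- An open-loop control is a feedback that ignores the position. -/
theorem IsTrajectory.isAdmissiblePair (ht : 0 ≤ t) (h : P.IsTrajectory ι 0 t v γ) :
    P.IsAdmissiblePair ι t (γ t) (fun _ s => v s) γ where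
  mem_U := fun _ s _ => (v s).2
  endpoint := rfl
  absolutelyContinuous := by
    refine h.speed.absolutelyContinuousOnInterval_tail.of_dist_le (C := 1) fun s hs r hr => ?_
    rw [uIcc_of_le ht] at hs hr
    rw [h.eq s hs, h.eq r hr, dist_sub_left, one_mul]
  measurable_control := continuous_subtype_val.comp_aestronglyMeasurable h.meas
  equation := by
    rw [ae_restrict_iff' measurableSet_Icc]
    filter_upwards [h.speed.ae_hasDerivAt_tail,
      (Ioo_ae_eq_Icc (a := 0) (b := t) (μ := volume)).mem_iff] with s h2 h3 hs
    rw [uIcc_of_le ht] at h2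
    have h4 := (hasDerivAt_const s (ι (γ t))).sub (h2 hs)
    rw [zero_sub, neg_neg] at h4
    refine h4.congr_of_eventuallyEq ?_
    filter_upwards [Icc_mem_nhds (h3.2 hs).1 (h3.2 hs).2] with r hr
    exact h.eq r hr
  integrable_cost := by
    rw [← intervalIntegrable_iff_integrableOn_Icc_of_le ht]
    exact h.cost

variable [CompactSpace M]

theorem Regular.exists_cost_le (hP : P.Regular ι) {u : EuclideanSpace ℝ (Fin m)} (hu : u ∈ P.U)
    (T : ℝ) : ∃ D, 0 ≤ D ∧ ∀ t ∈ Icc 0 T, ∀ x, P.L t x u ≤ D := by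
  have hc : ContinuousOn (fun z : ℝ × M => P.L z.1 z.2 u) ((Icc 0 T) ×ˢ univ) :=
    hP.continuous_L.comp (f := fun z : ℝ × M => (z.1, z.2, u)) (by fun_prop)
      fun z hz => ⟨hz.1.1, mem_univ _, hu⟩
  obtain ⟨D, hD⟩ := ((isCompact_Icc.prod isCompact_univ).image_of_continuousOn hc).bddAbove
  exact ⟨|D|, abs_nonneg _, fun t ht x =>
    (hD ⟨(t, x), ⟨ht, mem_univ _⟩, rfl⟩).trans (le_abs_self _)⟩

/-- Superlinearity of the cost makes the control integrable. -/
theorem Regular.intervalIntegrable_norm_control (hP : P.Regular ι) (ha : 0 ≤ a) (hab : a ≤ b)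
    (hv : AEStronglyMeasurable v (volume.restrict (Icc a b)))
    (hL : IntervalIntegrable (fun s => P.L s (γ s) (v s)) volume a b) :
    IntervalIntegrable (fun s => ‖(v s : EuclideanSpace ℝ (Fin m))‖) volume a b := by
  obtain ⟨C, -, hC⟩ := hP.exists_le_cost b 1
  have h1 : IntervalIntegrable (fun s => P.L s (γ s) (v s) + C) volume a b :=
    hL.add intervalIntegrable_const
  rw [intervalIntegrable_iff_integrableOn_Icc_of_le hab] at h1 ⊢
  refine h1.mono' (continuous_subtype_val.comp_aestronglyMeasurable hv).norm ?_
  rw [ae_restrict_iff' measurableSet_Icc]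
  refine .of_forall fun s hs => ?_
  have := hC s ⟨ha.trans hs.1, hs.2⟩ (γ s) (v s) (v s).2
  rw [norm_norm]
  linarith

/-- The open-loop control is `v s = u (γ s) s`. Integrability of the cost forces that of `v`, and
linear growth of `f` then forces that of the speed. The integral equation follows because `ι ∘ γ`
plus the tail integral of the speed is absolutely continuous with zero derivative almost everywhere.
-/
theorem IsAdmissiblePair.exists_isTrajectory (hP : P.Regular ι) (hι : Topology.IsEmbedding ι)
    (ht : 0 ≤ t) {u : M → ℝ → EuclideanSpace ℝ (Fin m)} (h : P.IsAdmissiblePair ι t x u γ) :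
    ∃ v, P.IsTrajectory ι 0 t v γ ∧ γ t = x ∧
      P.cost φ t u γ = (∫ s in (0 : ℝ)..t, P.L s (γ s) (v s)) + φ (γ 0) := by
  obtain ⟨u₀, hu₀⟩ := hP.nonempty
  classical
  -- Membership in `U` is known only for times in `[0, t]`; elsewhere an arbitrary `u₀` fills in.
  set v : ℝ → P.U := fun s => if hs : s ∈ Icc 0 t then ⟨u (γ s) s, h.mem_U _ s hs⟩ else ⟨u₀, hu₀⟩
    with hv
  have hvu : ∀ s ∈ Icc 0 t, (v s : EuclideanSpace ℝ (Fin m)) = u (γ s) s := fun s hs => by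
    simp only [hv, dif_pos hs]
  have hvm : AEStronglyMeasurable v (volume.restrict (Icc 0 t)) := by
    rw [← Topology.IsEmbedding.subtypeVal.aestronglyMeasurable_comp_iff]
    refine h.measurable_control.congr ?_
    rw [EventuallyEq, ae_restrict_iff' measurableSet_Icc]
    exact .of_forall fun s hs => (hvu s hs).symm
  have hL : IntervalIntegrable (fun s => P.L s (γ s) (v s)) volume 0 t := by
    rw [intervalIntegrable_iff_integrableOn_Icc_of_le ht]
    exact h.integrable_cost.congr_fun (fun s hs => by simp only [hvu s hs]) measurableSet_Icc
  have hγι : ContinuousOn (fun s => ι (γ s)) (Icc 0 t) := by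
    rw [← uIcc_of_le ht]; exact h.absolutelyContinuous.continuousOn
  have hγ : ContinuousOn γ (Icc 0 t) := hι.continuousOn_iff.2 hγι
  have hc := hP.intervalIntegrable_norm_control le_rfl ht hvm hL
  obtain ⟨K, hK0, hK⟩ := hP.exists_norm_ambient_le hι.continuous
  have hsp : IntervalIntegrable (fun s => P.ambient ι (γ s) (v s)) volume 0 t := by
    have h1 : IntervalIntegrable (fun s => K * (1 + ‖(v s : EuclideanSpace ℝ (Fin m))‖))
      volume 0 t := (intervalIntegrable_const.add hc).const_mul _
    rw [intervalIntegrable_iff_integrableOn_Icc_of_le ht] at h1 ⊢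
    exact h1.mono' (hP.aestronglyMeasurable_comp le_rfl hvm hγ hι).1
      (.of_forall fun s => hK _ _ (v s).2)
  refine ⟨v, ⟨⟨hvm, hc, hsp, ?_⟩, hL⟩, h.endpoint, ?_⟩
  · have hac := h.absolutelyContinuous.add hsp.absolutelyContinuousOnInterval_tail
    obtain ⟨C, hC⟩ := hac.const_of_ae_hasDerivAt_zero (by
      have h1 := h.equation
      rw [ae_restrict_iff' measurableSet_Icc] at h1
      filter_upwards [h1, hsp.ae_hasDerivAt_tail] with s h1 h2 hs
      have h3 := h2 hs
      rw [uIcc_of_le ht] at hs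
      rw [hvu s hs] at h3
      simpa using (h1 hs).add h3)
    intro s hs
    rw [uIcc_of_le ht] at hC
    have h1 := hC s hs
    have h2 := hC t (right_mem_Icc.2 ht)
    simp only [Pi.add_apply, intervalIntegral.integral_same, add_zero] at h1 h2
    rw [h2, ← h1, add_sub_cancel_right]
  · rw [cost]
    congr 1
    refine intervalIntegral.integral_congr fun s hs => ?_
    rw [uIcc_of_le ht] at hs
    simp only [hvu s hs]

/-- Unlike feedbacks, open-loop controls can be cut, concatenated and reused from another endpoint.
-/
theorem value_eq_sInf (hP : P.Regular ι) (hι : Topology.IsEmbedding ι) (ht : 0 ≤ t) (φ : M → ℝ)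
    (x : M) : P.value ι φ t x = sInf {c | ∃ v γ, P.IsTrajectory ι 0 t v γ ∧ γ t = x ∧
      c = (∫ s in (0 : ℝ)..t, P.L s (γ s) (v s)) + φ (γ 0)} := by
  rw [value]
  congr 1
  ext c
  constructor
  · rintro ⟨u, γ, h, rfl⟩
    obtain ⟨v, h1, h2, h3⟩ := h.exists_isTrajectory hP hι ht (φ := φ)
    exact ⟨v, γ, h1, h2, h3⟩
  · rintro ⟨v, γ, h, rfl, rfl⟩
    exact ⟨_, γ, h.isAdmissiblePair ht, rfl⟩

/-- A trajectory with a constant control. -/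
theorem Regular.exists_isTrajectory_const (hP : P.Regular ι)
    (hι : Manifold.IsSmoothEmbedding 𝓘(ℝ, EuclideanSpace ℝ (Fin n))
      𝓘(ℝ, EuclideanSpace ℝ (Fin N)) ∞ ι) (ha : 0 ≤ a) (hab : a ≤ b) (u : P.U) (x : M) :
    ∃ γ, P.IsTrajectory ι a b (fun _ => u) γ ∧ γ b = x := by
  obtain ⟨γ, hγ, hx⟩ := hP.exists_isSolution hι hab (v := fun _ => u)
    aestronglyMeasurable_const intervalIntegrable_const x
  refine ⟨γ, ⟨hγ, ?_⟩, hx⟩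
  refine ContinuousOn.intervalIntegrable_of_Icc hab ?_
  have h1 := hγ.continuousOn hι.isEmbedding hab
  refine hP.continuous_L.comp (f := fun s => (s, γ s, (u : EuclideanSpace ℝ (Fin m))))
    (by fun_prop) fun s hs => ⟨ha.trans hs.1, mem_univ _, u.2⟩

variable (hP : P.Regular ι) (hι : Manifold.IsSmoothEmbedding 𝓘(ℝ, EuclideanSpace ℝ (Fin n))
      𝓘(ℝ, EuclideanSpace ℝ (Fin N)) ∞ ι)
include hP hι

/-- A real `sInf` is a lower bound only for a set bounded below. Here the bound comes from
coercivity with slope `0` and from boundedness of `φ`. -/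
theorem value_le (hφ : ∃ B, ∀ x, |φ x| ≤ B) (ht : 0 ≤ t) (h : P.IsTrajectory ι 0 t v γ) :
    P.value ι φ t (γ t) ≤ (∫ s in (0 : ℝ)..t, P.L s (γ s) (v s)) + φ (γ 0) := by
  rw [value_eq_sInf hP hι.isEmbedding ht]
  refine csInf_le ?_ ⟨v, γ, h, rfl, rfl⟩
  obtain ⟨B, hB⟩ := hφ
  obtain ⟨C, -, hC⟩ := hP.exists_le_cost t 0
  refine ⟨-(C * t) - B, ?_⟩
  rintro _ ⟨v, γ, h, -, rfl⟩
  have h1 := h.le_integral_cost hC le_rfl ht le_rfl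
  have h2 := neg_le_of_abs_le (hB (γ 0))
  linarith

theorem exists_isTrajectory_le_value (ht : 0 ≤ t) (φ : M → ℝ) (x : M) {ε : ℝ} (hε : 0 < ε) :
    ∃ v γ, P.IsTrajectory ι 0 t v γ ∧ γ t = x ∧
      (∫ s in (0 : ℝ)..t, P.L s (γ s) (v s)) + φ (γ 0) ≤ P.value ι φ t x + ε := by
  obtain ⟨u₀, hu₀⟩ := hP.nonempty
  obtain ⟨γ₀, h₀, hx⟩ := hP.exists_isTrajectory_const hι le_rfl ht ⟨u₀, hu₀⟩ x
  have hne : {c | ∃ v γ, P.IsTrajectory ι 0 t v γ ∧ γ t = x ∧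
      c = (∫ s in (0 : ℝ)..t, P.L s (γ s) (v s)) + φ (γ 0)}.Nonempty :=
    ⟨_, _, _, h₀, hx, rfl⟩
  rw [value_eq_sInf hP hι.isEmbedding ht]
  obtain ⟨_, ⟨v, γ, h1, h2, rfl⟩, h3⟩ := exists_lt_of_csInf_lt hne (lt_add_of_pos_right _ hε)
  exact ⟨v, γ, h1, h2, h3.le⟩

theorem le_value_of_forall {r : ℝ} (ht : 0 ≤ t) (h : ∀ v γ, P.IsTrajectory ι 0 t v γ → γ t = x →
    r ≤ (∫ s in (0 : ℝ)..t, P.L s (γ s) (v s)) + φ (γ 0)) : r ≤ P.value ι φ t x := by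
  refine le_of_forall_pos_le_add fun ε hε => ?_
  obtain ⟨v, γ, h1, h2, h3⟩ := exists_isTrajectory_le_value hP hι ht φ x hε
  exact (h v γ h1 h2).trans h3

theorem value_zero (φ : M → ℝ) (hφ : ∃ B, ∀ x, |φ x| ≤ B) : P.value ι φ 0 = φ := by
  ext x
  refine le_antisymm ?_ (le_value_of_forall hP hι le_rfl fun v γ _ hx => by simp [hx])
  obtain ⟨u₀, hu₀⟩ := hP.nonempty
  obtain ⟨γ₀, h₀, rfl⟩ := hP.exists_isTrajectory_const hι le_rfl le_rfl ⟨u₀, hu₀⟩ x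
  simpa using value_le hP hι hφ le_rfl h₀

/-- The value function is bounded on compact time intervals. -/
theorem exists_abs_value_le (hφ : ∃ B, ∀ x, |φ x| ≤ B) (T : ℝ) :
    ∃ B, 0 ≤ B ∧ ∀ t ∈ Icc 0 T, ∀ x, |P.value ι φ t x| ≤ B := by
  obtain ⟨B, hB⟩ := id hφ
  obtain ⟨C, hC0, hC⟩ := hP.exists_le_cost T 0
  obtain ⟨u₀, hu₀⟩ := hP.nonempty
  obtain ⟨D, hD0', hD⟩ := hP.exists_cost_le hu₀ T
  refine ⟨|B| + C * |T| + D * |T|, by positivity, fun t ht x => ?_⟩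
  have htT : t ≤ |T| := ht.2.trans (le_abs_self _)
  have hD0 := mul_nonneg hD0' (abs_nonneg T)
  have hCT := mul_nonneg hC0 (abs_nonneg T)
  rw [abs_le]
  constructor
  · refine le_value_of_forall hP hι ht.1 fun v γ h _ => ?_
    have h1 := h.le_integral_cost hC le_rfl ht.1 ht.2
    have h2 := neg_le_of_abs_le ((hB (γ 0)).trans (le_abs_self B))
    have h3 := mul_le_mul_of_nonneg_left htT hC0
    linarith
  · obtain ⟨γ, h, rfl⟩ := hP.exists_isTrajectory_const hι le_rfl ht.1 ⟨u₀, hu₀⟩ x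
    refine (value_le hP hι hφ ht.1 h).trans ?_
    have h1 : ∫ s in (0 : ℝ)..t, P.L s (γ s) u₀ ≤ ∫ _s in (0 : ℝ)..t, D := by
      refine intervalIntegral.integral_mono_on ht.1 h.cost intervalIntegrable_const fun s hs => ?_
      exact hD s ⟨hs.1, hs.2.trans ht.2⟩ _
    have h2 := le_of_abs_le ((hB (γ 0)).trans (le_abs_self B))
    have h3 := mul_le_mul_of_nonneg_left htT hD0'
    simp only [intervalIntegral.integral_const, sub_zero, smul_eq_mul] at h1
    linarith

/-- Dynamic programming: the value function does not decrease the cost along trajectories. -/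
theorem value_le_integral_add_value (hφ : ∃ B, ∀ x, |φ x| ≤ B) (ha : 0 ≤ a) (hab : a ≤ b)
    (h : P.IsTrajectory ι a b v γ) :
    P.value ι φ b (γ b) ≤ (∫ s in a..b, P.L s (γ s) (v s)) + P.value ι φ a (γ a) := by
  refine le_of_forall_pos_le_add fun ε hε => ?_
  obtain ⟨w, δ, h1, h2, h3⟩ := exists_isTrajectory_le_value hP hι ha φ (γ a) hε
  obtain ⟨v', γ', h4, h5, h6, h7⟩ := h1.exists_concat h ha hab h2
  have h8 := value_le hP hι hφ (ha.trans hab) h4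
  rw [h6, h7, h5] at h8
  linarith

/-- Dynamic programming: existence of almost optimal trajectories. -/
theorem exists_integral_add_value_le (hφ : ∃ B, ∀ x, |φ x| ≤ B) (ha : 0 ≤ a) (hab : a ≤ b) (x : M)
    {ε : ℝ} (hε : 0 < ε) :
    ∃ v γ, P.IsTrajectory ι a b v γ ∧ γ b = x ∧
      (∫ s in a..b, P.L s (γ s) (v s)) + P.value ι φ a (γ a) ≤ P.value ι φ b x + ε := by
  obtain ⟨v, γ, h1, h2, h3⟩ := exists_isTrajectory_le_value hP hι (ha.trans hab) φ x hε
  refine ⟨v, γ, h1.mono_right ha hab, h2, ?_⟩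
  -- The initial piece, with its initial cost, is worth at least `V(a, γ(a))`; replacing it by this
  -- number keeps the inequality.
  have h4 := value_le hP hι hφ ha (h1.mono_left ha hab)
  rw [← intervalIntegral.integral_add_adjacent_intervals (h1.mono_left ha hab).cost
    (h1.mono_right ha hab).cost] at h3
  linarith

/-- Dynamic programming on `[s, s + t]`, moved to `[0, t]`. Boundedness of the initial cost
suffices, so `V(s, ·)` can serve as one before its continuity is known. -/
theorem value_add (hφ : ∃ B, ∀ x, |φ x| ≤ B) {s t : ℝ} (hs : 0 ≤ s) (ht : 0 ≤ t) :
    P.value ι φ (t + s) = (P.shift s).value ι (P.value ι φ s) t := by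
  have hφs : ∃ B, ∀ x, |P.value ι φ s x| ≤ B := by
    obtain ⟨B, -, hB⟩ := exists_abs_value_le hP hι hφ s
    exact ⟨B, hB s ⟨hs, le_rfl⟩⟩
  ext x
  rw [add_comm t s]
  refine le_antisymm ?_ ?_
  · refine le_value_of_forall (hP.shift hs) hι ht fun v γ h hx => ?_
    have h1 := h.of_shift
    rw [add_zero] at h1
    have h2 := value_le_integral_add_value hP hι hφ hs (le_add_of_nonneg_right ht) h1
    have h3 := integral_shift (P := P) (r := s) (t := t) (fun r => v (r - s)) (fun r => γ (r - s))
    simp only [add_sub_cancel_right, add_sub_cancel_left, sub_self] at h2 h3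
    rw [← h3, hx] at h2
    exact h2
  · refine le_of_forall_pos_le_add fun ε hε => ?_
    obtain ⟨v, γ, h1, h2, h3⟩ := exists_integral_add_value_le hP hι hφ hs
      (le_add_of_nonneg_right ht) x hε
    have h4 : P.IsTrajectory ι (s + 0) (s + t) v γ := by rwa [add_zero]
    have h5 := value_le (hP.shift hs) hι hφs ht h4.shift
    rw [integral_shift] at h5
    simp only [zero_add, add_comm t s, h2] at h5
    exact h5.trans h3

end
end ControlProblem

/-! ### Continuity of the value function -/

/-- At distances below `δ` uniform continuity gives `ε`; beyond `δ` the oscillation `2 |B|` is at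
most `2 |B| / δ` times the distance. -/
theorem exists_forall_sub_le_add_mul_norm {M E : Type*} [TopologicalSpace M] [CompactSpace M]
    [NormedAddCommGroup E] {ι : M → E} (hι : Topology.IsEmbedding ι) {φ : M → ℝ}
    (hφ : Continuous φ) {ε : ℝ} (hε : 0 < ε) :
    ∃ k, 0 ≤ k ∧ ∀ x y, φ x - φ y ≤ ε + k * ‖ι x - ι y‖ := by
  let : MetricSpace M := hι.comapMetricSpace ι
  have hu := CompactSpace.uniformContinuous_of_continuous hφ
  obtain ⟨δ, hδ, h⟩ := Metric.uniformContinuous_iff.1 hu ε hε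
  obtain ⟨B, hB⟩ := (isCompact_range hφ.norm).bddAbove
  refine ⟨2 * |B| / δ, by positivity, fun x y => ?_⟩
  have hd : dist x y = ‖ι x - ι y‖ := dist_eq_norm (ι x) (ι y)
  rcases lt_or_ge (dist x y) δ with h1 | h1
  · have h2 := (le_abs_self _).trans (h h1).le
    have : 0 ≤ 2 * |B| / δ * ‖ι x - ι y‖ := by positivity
    linarith
  · have h2 : 2 * |B| ≤ 2 * |B| / δ * ‖ι x - ι y‖ := by
      rw [← hd, div_mul_eq_mul_div, le_div_iff₀ hδ]
      gcongr
    have h3 := (le_abs_self (φ x)).trans ((hB ⟨x, rfl⟩ : ‖φ x‖ ≤ B).trans (le_abs_self B))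
    have h4 := (neg_le_abs (φ y)).trans ((hB ⟨y, rfl⟩ : ‖φ y‖ ≤ B).trans (le_abs_self B))
    linarith

/-- Continuous functions are uniform limits of Lipschitz functions. -/
theorem exists_lipschitz_approx {M E : Type*} [TopologicalSpace M] [CompactSpace M]
    [NormedAddCommGroup E] {ι : M → E} (hι : Topology.IsEmbedding ι) {φ : M → ℝ}
    (hφ : Continuous φ) {ε : ℝ} (hε : 0 < ε) :
    ∃ φ' : M → ℝ, ∃ Λ, 0 ≤ Λ ∧ (∀ x y, |φ' x - φ' y| ≤ Λ * ‖ι x - ι y‖) ∧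
      ∀ x, |φ x - φ' x| ≤ ε := by
  obtain ⟨k, hk0, hk⟩ := exists_forall_sub_le_add_mul_norm hι hφ hε
  -- The approximation is the inf-convolution with slope `k`. This bound shows both that the infimum
  -- is finite and that it loses at most `ε`.
  have hlb : ∀ x, φ x - ε ∈ lowerBounds (range fun y => φ y + k * ‖ι x - ι y‖) := by
    rintro x _ ⟨y, rfl⟩
    have := hk x y
    simp only
    linarith
  have hle : ∀ x y, sInf (range fun y => φ y + k * ‖ι x - ι y‖) ≤ φ y + k * ‖ι x - ι y‖ :=
    fun x y => csInf_le ⟨_, hlb x⟩ ⟨y, rfl⟩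
  have hstep : ∀ x y, sInf (range fun z => φ z + k * ‖ι x - ι z‖) ≤
      sInf (range fun z => φ z + k * ‖ι y - ι z‖) + k * ‖ι x - ι y‖ := fun x y => by
    rw [← sub_le_iff_le_add]
    refine le_csInf ⟨_, x, rfl⟩ ?_
    rintro _ ⟨z, rfl⟩
    have h1 := hle x z
    have h2 := mul_le_mul_of_nonneg_left (norm_sub_le_norm_sub_add_norm_sub (ι x) (ι y) (ι z)) hk0
    simp only
    linarith
  refine ⟨fun x => sInf (range fun y => φ y + k * ‖ι x - ι y‖), k, hk0, fun x y => ?_, fun x => ?_⟩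
  · have h1 := hstep x y
    have h2 := hstep y x
    rw [norm_sub_rev] at h2
    exact abs_sub_le_iff.2 ⟨by linarith, by linarith⟩
  · have h1 := hle x x
    have h2 : φ x - ε ≤ sInf (range fun y => φ y + k * ‖ι x - ι y‖) := le_csInf ⟨_, x, rfl⟩ (hlb x)
    simp only [sub_self, norm_zero, mul_zero, add_zero] at h1
    exact abs_sub_le_iff.2 ⟨by linarith, by linarith⟩

namespace ControlProblem

section
variable {n m N : ℕ} {M : Type*} [TopologicalSpace M] [CompactSpace M]
  [ChartedSpace (EuclideanSpace ℝ (Fin n)) M]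
  {P : ControlProblem n m M} {ι : M → EuclideanSpace ℝ (Fin N)} {a b c t : ℝ} {v w : ℝ → P.U}
  {γ δ : ℝ → M} {φ : M → ℝ} {x : M}

variable (hP : P.Regular ι) (hι : Manifold.IsSmoothEmbedding 𝓘(ℝ, EuclideanSpace ℝ (Fin n))
      𝓘(ℝ, EuclideanSpace ℝ (Fin N)) ∞ ι)
include hP hι

/-- For a Lipschitz initial cost the value function is Lipschitz in space. -/
theorem exists_lipschitz_value_space (hφ : ∃ B, ∀ x, |φ x| ≤ B)
    (hφL : ∃ Λ, 0 ≤ Λ ∧ ∀ x y, |φ x - φ y| ≤ Λ * ‖ι x - ι y‖) (T : ℝ) :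
    ∃ Λ, 0 ≤ Λ ∧ ∀ t ∈ Icc 0 T, ∀ x y,
      |P.value ι φ t x - P.value ι φ t y| ≤ Λ * ‖ι x - ι y‖ := by
  obtain ⟨Λ, hΛ0, hΛ⟩ := hφL
  obtain ⟨B, hB⟩ := id hφ
  obtain ⟨B', hB'0, hB'⟩ := exists_abs_value_le hP hι hφ T
  obtain ⟨C, hC0, hC⟩ := hP.exists_le_cost T 1
  obtain ⟨K, hK0, hK⟩ := hP.exists_lipschitz_ambient
  obtain ⟨α, hα0, hα⟩ := hP.exists_lipschitz_cost T
  -- `Q` bounds the `L¹` norm of an almost optimal control: its total cost is at most `B' + 1`, its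
  -- initial cost at least `-|B|`, and coercivity has slope `1`. `Γ` is the resulting Gronwall
  -- factor.
  set Q := B' + 1 + |B| + C * |T| with hQ
  set Γ := Real.exp (K * (|T| + Q)) with hΓ
  have main : ∀ t ∈ Icc 0 T, ∀ x y,
      P.value ι φ t x - P.value ι φ t y ≤ (α * |T| + Λ) * Γ * ‖ι x - ι y‖ := by
    intro t ht x y
    have htT : t ≤ |T| := ht.2.trans (le_abs_self _)
    refine sub_le_iff_le_add.2 (le_of_forall_pos_le_add fun ε hε => ?_)
    -- The accuracy is capped at `1` so that `Q` does not depend on `ε`.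
    obtain ⟨v, γ, hγ, rfl, hle⟩ := exists_isTrajectory_le_value hP hι ht.1 φ y
      (lt_min hε one_pos)
    -- The control that is almost optimal for `y` is run backwards from `x`.
    obtain ⟨δ, hδ, rfl⟩ := hP.exists_isSolution hι ht.1 hγ.meas hγ.control x
    have hcontrol : ∫ s in (0 : ℝ)..t, ‖(v s : EuclideanSpace ℝ (Fin m))‖ ≤ Q := by
      have h1 := hγ.le_integral_cost hC le_rfl ht.1 ht.2
      have h2 := neg_le_of_abs_le ((hB (γ 0)).trans (le_abs_self B))
      have h3 := le_of_abs_le (hB' t ht (γ t))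
      have h4 := min_le_right ε 1
      have h5 := mul_le_mul_of_nonneg_left htT hC0
      rw [hQ]
      linarith
    set D := ‖ι (δ t) - ι (γ t)‖ * Γ with hD
    have hdist : ∀ s ∈ Icc 0 t, ‖ι (δ s) - ι (γ s)‖ ≤ D := fun s hs => by
      refine ((hδ.mono_right hs.1 hs.2).dist_le_mul_exp (hγ.toIsSolution.mono_right hs.1 hs.2) hs.2
        hK0 hK).trans ?_
      have hvs := (hγ.mono_right hs.1 hs.2).control
      have h1 : ∫ r in s..t, K * (1 + ‖(v r : EuclideanSpace ℝ (Fin m))‖) ≤ K * (|T| + Q) := by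
        rw [intervalIntegral.integral_const_mul,
          intervalIntegral.integral_add intervalIntegrable_const hvs]
        have h2 : ∫ r in s..t, ‖(v r : EuclideanSpace ℝ (Fin m))‖ ≤ Q := by
          refine le_trans ?_ hcontrol
          rw [← intervalIntegral.integral_add_adjacent_intervals
            (hγ.mono_left hs.1 hs.2).control hvs]
          have : 0 ≤ ∫ r in (0 : ℝ)..s, ‖(v r : EuclideanSpace ℝ (Fin m))‖ :=
            intervalIntegral.integral_nonneg hs.1 fun r _ => norm_nonneg _
          linarith
        refine mul_le_mul_of_nonneg_left (add_le_add ?_ h2) hK0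
        simp only [intervalIntegral.integral_const, smul_eq_mul, mul_one]
        linarith [hs.1]
      exact mul_le_mul_of_nonneg_left (Real.exp_le_exp.2 h1) (norm_nonneg _)
    have hm := (hP.aestronglyMeasurable_comp le_rfl hδ.meas (hδ.continuousOn hι.isEmbedding ht.1)
      hι.isEmbedding).2
    have hbound : ∀ s ∈ Icc 0 t, P.L s (δ s) (v s) ≤ P.L s (γ s) (v s) + α * D := fun s hs => by
      have h1 := le_of_abs_le (hα s ⟨hs.1, hs.2.trans ht.2⟩ (γ s) (δ s) (v s) (v s).2)
      have h2 := mul_le_mul_of_nonneg_left (hdist s hs) hα0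
      linarith
    have hcost : IntervalIntegrable (fun s => P.L s (δ s) (v s)) volume 0 t := by
      have h1 : IntervalIntegrable (fun s => ‖P.L s (γ s) (v s)‖ + α * D) volume 0 t :=
        hγ.cost.norm.add intervalIntegrable_const
      rw [intervalIntegrable_iff_integrableOn_Icc_of_le ht.1] at h1 ⊢
      refine h1.mono' hm ((ae_restrict_iff' measurableSet_Icc).2 (.of_forall fun s hs => ?_))
      have h2 := hα s ⟨hs.1, hs.2.trans ht.2⟩ (γ s) (δ s) (v s) (v s).2
      have h3 := mul_le_mul_of_nonneg_left (hdist s hs) hα0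
      have h4 := norm_le_norm_add_norm_sub' (P.L s (δ s) (v s)) (P.L s (γ s) (v s))
      rw [Real.norm_eq_abs (_ - _)] at h4
      linarith
    have h1 := value_le hP hι hφ ht.1 (⟨hδ, hcost⟩ : P.IsTrajectory ι 0 t v δ)
    have h2 : ∫ s in (0 : ℝ)..t, P.L s (δ s) (v s) ≤
        (∫ s in (0 : ℝ)..t, P.L s (γ s) (v s)) + α * |T| * D := by
      have h3 := intervalIntegral.integral_mono_on ht.1 hcost
        (hγ.cost.add (intervalIntegrable_const (c := α * D))) hbound
      rw [intervalIntegral.integral_add hγ.cost intervalIntegrable_const] at h3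
      simp only [intervalIntegral.integral_const, sub_zero, smul_eq_mul] at h3
      have h4 : t * (α * D) ≤ α * |T| * D := by
        rw [← mul_assoc, mul_comm t]; gcongr
      linarith
    have h3 := le_of_abs_le ((hΛ (δ 0) (γ 0)).trans
      (mul_le_mul_of_nonneg_left (hdist 0 ⟨le_rfl, ht.1⟩) hΛ0))
    have h4 := min_le_left ε 1
    calc _ ≤ _ := h1
      _ ≤ P.value ι φ t (γ t) + ε + (α * |T| + Λ) * D := by linarith
      _ = _ := by rw [hD]; ring
  refine ⟨(α * |T| + Λ) * Γ, by positivity, fun t ht x y => ?_⟩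
  refine abs_sub_le_iff.2 ⟨main t ht x y, ?_⟩
  rw [norm_sub_rev]
  exact main t ht y x

/-- For a Lipschitz initial cost the value function is Lipschitz in time. -/
theorem exists_lipschitz_value_time (hφ : ∃ B, ∀ x, |φ x| ≤ B)
    (hφL : ∃ Λ, 0 ≤ Λ ∧ ∀ x y, |φ x - φ y| ≤ Λ * ‖ι x - ι y‖) (T : ℝ) :
    ∃ Λ, 0 ≤ Λ ∧ ∀ t ∈ Icc 0 T, ∀ s ∈ Icc 0 T, ∀ x,
      |P.value ι φ t x - P.value ι φ s x| ≤ Λ * |t - s| := by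
  obtain ⟨Λ, hΛ0, hΛ⟩ := exists_lipschitz_value_space hP hι hφ hφL T
  obtain ⟨K, hK0, hK⟩ := hP.exists_norm_ambient_le hι.isEmbedding.continuous
  -- With slope `Λ * K` the running cost pays for the variation of `V(s, ·)`, which is at most `Λ`
  -- times the displacement `K * ((t - s) + ∫ ‖v‖)`.
  obtain ⟨C, hC0, hC⟩ := hP.exists_le_cost T (Λ * K)
  obtain ⟨u₀, hu₀⟩ := hP.nonempty
  obtain ⟨D, hD0, hD⟩ := hP.exists_cost_le hu₀ T
  set Θ := D + Λ * K * (1 + ‖u₀‖) + (C + Λ * K) with hΘ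
  have hΘ0 : 0 ≤ Θ := by positivity
  have main : ∀ s ∈ Icc 0 T, ∀ t ∈ Icc 0 T, s ≤ t → ∀ x,
      |P.value ι φ t x - P.value ι φ s x| ≤ Θ * (t - s) := by
    intro s hs t ht hst x
    have hts := sub_nonneg.2 hst
    have hlip : ∀ y, |P.value ι φ s y - P.value ι φ s x| ≤ Λ * ‖ι x - ι y‖ := fun y => by
      rw [norm_sub_rev]; exact hΛ s hs y x
    refine abs_sub_le_iff.2 ⟨?_, ?_⟩
    · obtain ⟨γ, h, rfl⟩ := hP.exists_isTrajectory_const hι hs.1 hst ⟨u₀, hu₀⟩ x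
      have h1 := value_le_integral_add_value hP hι hφ hs.1 hst h
      have h2 : ∫ r in s..t, P.L r (γ r) u₀ ≤ ∫ _r in s..t, D :=
        intervalIntegral.integral_mono_on hst h.cost intervalIntegrable_const
          fun r hr => hD r ⟨hs.1.trans hr.1, hr.2.trans ht.2⟩ _
      have h3 := h.norm_displacement_le hK hst
      have h4 := le_of_abs_le ((hlip (γ s)).trans (mul_le_mul_of_nonneg_left h3 hΛ0))
      simp only [intervalIntegral.integral_const, smul_eq_mul] at h2 h4
      have h5 : 0 ≤ (C + Λ * K) * (t - s) := by positivity
      rw [hΘ]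
      linarith
    · refine sub_le_iff_le_add.2 (le_of_forall_pos_le_add fun ε hε => ?_)
      obtain ⟨v, γ, h, rfl, h1⟩ := exists_integral_add_value_le hP hι hφ hs.1 hst x hε
      have h2 := h.le_integral_cost hC hs.1 hst ht.2
      have h3 := h.norm_displacement_le hK hst
      have h4 := neg_le_of_abs_le ((hlip (γ s)).trans (mul_le_mul_of_nonneg_left h3 hΛ0))
      have h5 : 0 ≤ (D + Λ * K * (1 + ‖u₀‖)) * (t - s) := by positivity
      rw [hΘ]
      linarith
  refine ⟨Θ, hΘ0, fun t ht s hs x => ?_⟩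
  rcases le_total s t with h | h
  · rw [abs_of_nonneg (sub_nonneg.2 h)]
    exact main s hs t ht h x
  · rw [abs_sub_comm, abs_sub_comm t, abs_of_nonneg (sub_nonneg.2 h)]
    exact main t ht s hs h x

/-- The solution operator is monotone and commutes with constants, hence is nonexpansive in the sup
norm. This carries results from Lipschitz to continuous data. -/
theorem value_le_value_add {φ' : M → ℝ} {ε : ℝ} (hφ : ∃ B, ∀ x, |φ x| ≤ B)
    (h : ∀ x, φ x ≤ φ' x + ε) (ht : 0 ≤ t) (x : M) :
    P.value ι φ t x ≤ P.value ι φ' t x + ε := by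
  rw [← sub_le_iff_le_add]
  refine le_value_of_forall hP hι ht fun v γ hγ hx => ?_
  have h1 := value_le hP hι hφ ht hγ
  rw [hx] at h1
  linarith [h (γ 0)]

theorem continuousOn_value_of_lipschitz (hφ : ∃ B, ∀ x, |φ x| ≤ B)
    (hφL : ∃ Λ, 0 ≤ Λ ∧ ∀ x y, |φ x - φ y| ≤ Λ * ‖ι x - ι y‖) :
    ContinuousOn (fun z : ℝ × M => P.value ι φ z.1 z.2) (Ici 0 ×ˢ univ) := by
  rintro ⟨t, x⟩ ⟨ht, -⟩
  have ht : 0 ≤ t := ht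
  obtain ⟨Λ, hΛ0, hΛ⟩ := exists_lipschitz_value_space hP hι hφ hφL (t + 1)
  obtain ⟨Θ, hΘ0, hΘ⟩ := exists_lipschitz_value_time hP hι hφ hφL (t + 1)
  rw [ContinuousWithinAt, tendsto_iff_norm_sub_tendsto_zero]
  have hlim : Tendsto (fun z : ℝ × M => Θ * |z.1 - t| + Λ * ‖ι z.2 - ι x‖)
      (𝓝[Ici 0 ×ˢ univ] (t, x)) (𝓝 0) := by
    have hc : Continuous fun z : ℝ × M => Θ * |z.1 - t| + Λ * ‖ι z.2 - ι x‖ := by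
      have := hι.isEmbedding.continuous
      fun_prop
    have := (hc.tendsto (t, x)).mono_left (nhdsWithin_le_nhds (s := Ici 0 ×ˢ univ))
    simpa using this
  refine squeeze_zero' (.of_forall fun _ => norm_nonneg _) ?_ hlim
  have h1 : ∀ᶠ z : ℝ × M in 𝓝[Ici 0 ×ˢ univ] (t, x), z.1 ≤ t + 1 :=
    nhdsWithin_le_nhds (continuous_fst.continuousAt.eventually_le_const (by simp))
  filter_upwards [h1, self_mem_nhdsWithin] with z hz1 hz2
  have hz : z.1 ∈ Icc 0 (t + 1) := ⟨hz2.1, hz1⟩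
  have h2 := hΘ z.1 hz t ⟨ht, by linarith⟩ x
  have h3 := hΛ z.1 hz z.2 x
  rw [Real.norm_eq_abs]
  calc _ ≤ |P.value ι φ z.1 z.2 - P.value ι φ z.1 x| + |P.value ι φ z.1 x - P.value ι φ t x| :=
        abs_sub_le _ _ _
    _ ≤ _ := by linarith

theorem continuousOn_value (φ : C(M, ℝ)) :
    ContinuousOn (fun z : ℝ × M => P.value ι φ z.1 z.2) (Ici 0 ×ˢ univ) := by
  have hb : ∀ {φ : M → ℝ}, Continuous φ → ∃ B, ∀ x, |φ x| ≤ B := fun {φ} h => by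
    obtain ⟨B, hB⟩ := (isCompact_range h.norm).bddAbove
    exact ⟨B, fun x => hB ⟨x, rfl⟩⟩
  refine continuousOn_of_uniform_approx_of_continuousOn fun u hu => ?_
  obtain ⟨ε, hε, hεu⟩ := Metric.mem_uniformity_dist.1 hu
  obtain ⟨φ', Λ, hΛ0, hΛ, hφ'⟩ := exists_lipschitz_approx hι.isEmbedding φ.continuous (half_pos hε)
  have hbφ := hb φ.continuous
  have hbφ' : ∃ B, ∀ x, |φ' x| ≤ B := by
    obtain ⟨B, hB⟩ := hbφ
    refine ⟨B + ε / 2, fun x => ?_⟩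
    have h1 := hφ' x
    have h2 := abs_sub_abs_le_abs_sub (φ' x) (φ x)
    rw [abs_sub_comm] at h2
    linarith [hB x]
  refine ⟨_, continuousOn_value_of_lipschitz hP hι hbφ' ⟨Λ, hΛ0, hΛ⟩, fun z hz => hεu ?_⟩
  have h1 := value_le_value_add hP hι hbφ (φ' := φ') (ε := ε / 2)
    (fun x => by have := le_of_abs_le (hφ' x); linarith) hz.1 z.2
  have h2 := value_le_value_add hP hι hbφ' (φ' := φ) (ε := ε / 2)
    (fun x => by have := neg_le_of_abs_le (hφ' x); linarith) hz.1 z.2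
  rw [Real.dist_eq]
  refine lt_of_le_of_lt (abs_sub_le_iff.2 ⟨?_, ?_⟩) (half_lt_self hε) <;> linarith

end
end ControlProblem

/-! ### The value function is a viscosity solution -/

/-- Trajectories run backwards from `(t₀, x₀)`, so only left derivatives at `t₀` are available. -/
theorem HasDerivWithinAt.nonpos_of_forall_le_left {g : ℝ → ℝ} {g' t : ℝ}
    (hg : HasDerivWithinAt g g' (Iic t) t) (h : ∀ᶠ s in 𝓝[<] t, g t ≤ g s) : g' ≤ 0 := by
  have h1 := (hasDerivWithinAt_iff_tendsto_slope' (s := Iio t) (by simp)).1 (hg.mono Iio_subset_Iic_self)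
  refine le_of_tendsto h1 ?_
  filter_upwards [h, self_mem_nhdsWithin] with s hs hst
  rw [slope_def_field]
  exact div_nonpos_of_nonneg_of_nonpos (sub_nonneg.2 hs) (sub_nonpos.2 (le_of_lt hst))

theorem ContinuousOn.hasDerivWithinAt_integral_tail {E : Type*} [NormedAddCommGroup E]
    [NormedSpace ℝ E] [CompleteSpace E] {g : ℝ → E} {a b : ℝ} (hab : a < b)
    (hg : ContinuousOn g (Icc a b)) :
    HasDerivWithinAt (fun s => ∫ r in s..b, g r) (-g b) (Iic b) b := by
  have hmem : Icc a b ∈ 𝓝[≤] b := Icc_mem_nhdsLE hab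
  exact intervalIntegral.integral_hasDerivWithinAt_left IntervalIntegrable.refl
    ⟨Icc a b, hmem, hg.aestronglyMeasurable measurableSet_Icc⟩
    ((hg b (right_mem_Icc.2 hab.le)).mono_of_mem_nhdsWithin hmem)

namespace ControlProblem

section
variable {n m N : ℕ} {M : Type*} [TopologicalSpace M] [CompactSpace M]
  [ChartedSpace (EuclideanSpace ℝ (Fin n)) M]
  {P : ControlProblem n m M} {ι : M → EuclideanSpace ℝ (Fin N)} {a b c t : ℝ} {v w : ℝ → P.U}
  {γ δ : ℝ → M} {φ : M → ℝ} {x : M}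

omit [CompactSpace M] in
-- Covectors at different points of `M` live in different spaces. Expressing them through a
-- functional `q` on `ℝᴺ` lets one momentum be used at neighbouring points.
theorem hjOperator_eq {ψ : ℝ → M → ℝ} {q : EuclideanSpace ℝ (Fin N) →L[ℝ] ℝ}
    (h : ∀ w : TangentSpace 𝓘(ℝ, EuclideanSpace ℝ (Fin n)) x,
      mfderiv 𝓘(ℝ, EuclideanSpace ℝ (Fin n)) 𝓘(ℝ, ℝ) (ψ t) x w =
      q (mfderiv 𝓘(ℝ, EuclideanSpace ℝ (Fin n)) 𝓘(ℝ, EuclideanSpace ℝ (Fin N)) ι x w)) :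
    P.hjOperator ψ t x = deriv (fun s => ψ s x) t +
      sSup ((fun u => q (P.ambient ι x u) - P.L t x u) '' P.U) := by
  unfold hjOperator hamiltonian
  congr 1
  exact congrArg sSup (image_congr fun u _ => congrArg (· - P.L t x u) (h _))

/-- The slope `|A| * K + 1` dominates `A * ‖f‖` and leaves one `‖u‖` to spare, which confines almost
maximising controls to a ball. -/
theorem Regular.exists_mul_norm_ambient_sub_le (hP : P.Regular ι) (hι : Continuous ι) (T A : ℝ) :
    ∃ C, 0 ≤ C ∧ ∀ t ∈ Icc 0 T, ∀ x, ∀ u ∈ P.U, A * ‖P.ambient ι x u‖ + ‖u‖ - C ≤ P.L t x u := by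
  obtain ⟨K, hK0, hK⟩ := hP.exists_norm_ambient_le hι
  obtain ⟨C, hC0, hC⟩ := hP.exists_le_cost T (|A| * K + 1)
  refine ⟨C + |A| * K, by positivity, fun t ht x u hu => ?_⟩
  have h1 := hC t ht x u hu
  have h2 : A * ‖P.ambient ι x u‖ ≤ |A| * (K * (1 + ‖u‖)) :=
    mul_le_mul (le_abs_self _) (hK x u hu) (norm_nonneg _) (abs_nonneg _)
  linarith

theorem Regular.bddAbove_hamiltonian (hP : P.Regular ι) (hι : Continuous ι) (ht : 0 ≤ t) (x : M)
    (q : EuclideanSpace ℝ (Fin N) →L[ℝ] ℝ) :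
    BddAbove ((fun u => q (P.ambient ι x u) - P.L t x u) '' P.U) := by
  obtain ⟨C, -, hC⟩ := hP.exists_mul_norm_ambient_sub_le hι t ‖q‖
  refine ⟨C, ?_⟩
  rintro _ ⟨u, hu, rfl⟩
  have h1 := hC t ⟨ht, le_rfl⟩ x u hu
  have h2 := (le_abs_self _).trans (q.le_opNorm (P.ambient ι x u))
  have h3 := norm_nonneg u
  simp only
  linarith

/-- If the Hamilton–Jacobi operator is negative at a point then the corresponding inequality
holds uniformly in the control in a neighbourhood of that point. -/
theorem Regular.eventually_forall_le (hP : P.Regular ι) (hι : Continuous ι) (ht : 0 < t) (x : M)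
    (q : EuclideanSpace ℝ (Fin N) →L[ℝ] ℝ) {d θ : ℝ} (hθ : 0 < θ)
    (h : ∀ u ∈ P.U, 3 * θ ≤ P.L t x u - d - q (P.ambient ι x u)) :
    ∃ η, 0 < η ∧ ∀ᶠ z : ℝ × M in 𝓝 (t, x), ∀ u ∈ P.U,
      θ ≤ P.L z.1 z.2 u - d - q (P.ambient ι z.2 u) - η * (1 + ‖P.ambient ι z.2 u‖) := by
  obtain ⟨K, hK0, hK⟩ := hP.exists_norm_ambient_le hι
  obtain ⟨C, hC0, hC⟩ := hP.exists_mul_norm_ambient_sub_le hι (t + 1) (‖q‖ + 1)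
  -- For `‖u‖ ≥ R` the spare `‖u‖` gives the claim, provided `η ≤ 1`. For `‖u‖ ≤ R` compactness
  -- keeps a margin `2 * θ` near `(t, x)`, and the second bound on `η` makes the `η` term cost at
  -- most `θ`.
  set R := θ + |d| + 1 + C with hR
  have hR0 : 0 ≤ R := by positivity
  set η := min 1 (θ / (1 + K * (1 + R))) with hη
  have hη0 : 0 < η := by positivity
  refine ⟨η, hη0, ?_⟩
  have hcpt : IsCompact {u : P.U | ‖(u : EuclideanSpace ℝ (Fin m))‖ ≤ R} := by
    have := hP.isClosed.isClosedEmbedding_subtypeVal.isCompact_preimage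
      (isCompact_closedBall (0 : EuclideanSpace ℝ (Fin m)) R)
    simpa [preimage, Metric.closedBall] using this
  have hG : Continuous fun z : (ℝ × M) × P.U =>
      P.L (max z.1.1 0) z.1.2 z.2 - d - q (P.ambient ι z.1.2 z.2) := by
    have h1 := hP.continuous_cost.comp
      (f := fun z : (ℝ × M) × P.U => (z.1.1, z.1.2, z.2)) (by fun_prop)
    have h2 := hP.continuous_ambient.comp (f := fun z : (ℝ × M) × P.U => (z.1.2, z.2)) (by fun_prop)
    exact (h1.sub continuous_const).sub (q.continuous.comp h2)
  have hev := hcpt.eventually_forall_of_forall_eventually (x₀ := (t, x))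
    (P := fun z u => 2 * θ < P.L (max z.1 0) z.2 u - d - q (P.ambient ι z.2 u)) fun u _ => by
      refine hG.continuousAt.eventually_const_lt ?_
      have := h u u.2
      simp only [max_eq_left ht.le]
      linarith
  have h1 : ∀ᶠ z : ℝ × M in 𝓝 (t, x), z.1 < t + 1 :=
    continuous_fst.continuousAt.eventually_lt_const (by simp)
  have h2 : ∀ᶠ z : ℝ × M in 𝓝 (t, x), 0 < z.1 :=
    continuous_fst.continuousAt.eventually_const_lt ht
  filter_upwards [hev, h1, h2] with z hz hz1 hz2 u hu
  rcases le_total ‖u‖ R with huR | huR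
  · have h3 := hz ⟨u, hu⟩ huR
    simp only [max_eq_left hz2.le] at h3
    have h4 : η * (1 + ‖P.ambient ι z.2 u‖) ≤ θ := by
      have h5 : 1 + ‖P.ambient ι z.2 u‖ ≤ 1 + K * (1 + R) := by
        have := hK z.2 u hu
        have : K * (1 + ‖u‖) ≤ K * (1 + R) := by gcongr
        linarith
      calc η * (1 + ‖P.ambient ι z.2 u‖) ≤ θ / (1 + K * (1 + R)) * (1 + K * (1 + R)) := by
            gcongr; exact min_le_right _ _
        _ = θ := by field_simp
    linarith
  · have h3 := hC z.1 ⟨hz2.le, hz1.le⟩ z.2 u hu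
    have h4 := (le_abs_self _).trans (q.le_opNorm (P.ambient ι z.2 u))
    have h5 : η * (1 + ‖P.ambient ι z.2 u‖) ≤ 1 * (1 + ‖P.ambient ι z.2 u‖) := by
      gcongr; exact min_le_left _ _
    have h6 := le_abs_self d
    linarith

variable [IsManifold 𝓘(ℝ, EuclideanSpace ℝ (Fin n)) ∞ M]
variable (hP : P.Regular ι) (hι : Manifold.IsSmoothEmbedding 𝓘(ℝ, EuclideanSpace ℝ (Fin n))
      𝓘(ℝ, EuclideanSpace ℝ (Fin N)) ∞ ι)
include hP hι

/-- For a constant control `u`, dynamic programming and maximality show that `ψ(s, γ(s)) + ∫_s^{t₀}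
L` is smallest at `s = t₀`. Its left derivative `ψ_t + ψ_x f - L` is therefore nonpositive; then the
supremum over `u` is taken. -/
theorem value_subsolution (hφ : ∃ B, ∀ x, |φ x| ≤ B) {ψ : ℝ → M → ℝ}
    (hψ : ContMDiff (𝓘(ℝ, ℝ).prod 𝓘(ℝ, EuclideanSpace ℝ (Fin n))) 𝓘(ℝ, ℝ) 1
      (fun z : ℝ × M => ψ z.1 z.2)) {t₀ : ℝ} {x₀ : M} (ht₀ : 0 < t₀)
    (hmax : IsLocalMax (fun z : ℝ × M => P.value ι φ z.1 z.2 - ψ z.1 z.2) (t₀, x₀)) :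
    P.hjOperator ψ t₀ x₀ ≤ 0 := by
  obtain ⟨Ψ, Ψ', hΨ, hΨψ, hd, hq⟩ :=
    exists_ambient_extension (hι.isImmersion.isImmersionAt x₀) hψ t₀
  rw [hjOperator_eq (q := Ψ'.comp (ContinuousLinearMap.inr ℝ ℝ _)) hq, hd,
    ← le_neg_iff_add_nonpos_left]
  refine csSup_le (hP.nonempty.image _) ?_
  rintro _ ⟨u, hu, rfl⟩
  obtain ⟨γ, hγ, hx⟩ := hP.exists_isTrajectory_const hι le_rfl ht₀.le ⟨u, hu⟩ x₀
  have hγc := hγ.continuousOn hι.isEmbedding ht₀.le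
  have ht₀' : t₀ ∈ Icc 0 t₀ := right_mem_Icc.2 ht₀.le
  have hγ' : HasDerivWithinAt (fun s => ι (γ s)) (P.ambient ι x₀ u) (Iic t₀) t₀ := by
    have hc : ContinuousOn (fun s => P.ambient ι (γ s) u) (Icc 0 t₀) :=
      hP.continuous_ambient.comp_continuousOn (f := fun s => (γ s, (⟨u, hu⟩ : P.U))) (by fun_prop)
    have h1 := (hc.hasDerivWithinAt_integral_tail ht₀).const_sub (ι (γ t₀))
    rw [neg_neg, hx] at h1
    refine h1.congr_of_eventuallyEq ?_ (by simp [hx])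
    filter_upwards [Icc_mem_nhdsLE ht₀] with s hs
    rw [hγ.eq s hs, hx]
  have hL : HasDerivWithinAt (fun s => ∫ r in s..t₀, P.L r (γ r) u) (-P.L t₀ x₀ u)
      (Iic t₀) t₀ := by
    have hc : ContinuousOn (fun s => P.L s (γ s) u) (Icc 0 t₀) :=
      hP.continuous_L.comp (f := fun s => (s, γ s, u)) (by fun_prop)
        fun s hs => ⟨hs.1, mem_univ _, hu⟩
    have h1 := hc.hasDerivWithinAt_integral_tail ht₀
    rwa [hx] at h1
  have hg := (HasFDerivAt.comp_hasDerivWithinAt (f := fun s => (s, ι (γ s))) t₀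
    (by rw [hx]; exact hΨ) ((hasDerivWithinAt_id t₀ (Iic t₀)).prodMk hγ')).add hL
  have hle := hg.nonpos_of_forall_le_left ?_
  · have h1 : Ψ' (1, P.ambient ι x₀ u) = Ψ' (1, 0) + Ψ' (0, P.ambient ι x₀ u) := by
      rw [← map_add]; simp
    simp only [ContinuousLinearMap.comp_apply, ContinuousLinearMap.inr_apply]
    linarith
  · have htend : Tendsto (fun s => (s, γ s)) (𝓝[<] t₀) (𝓝 (t₀, x₀)) := by
      have h1 : Tendsto γ (𝓝[<] t₀) (𝓝 x₀) := by
        rw [← hx]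
        exact (hγc t₀ ht₀').mono_of_mem_nhdsWithin (Icc_mem_nhdsLT ht₀)
      exact (tendsto_id.mono_left nhdsWithin_le_nhds).prodMk_nhds h1
    have htend' : Tendsto γ (𝓝[<] t₀) (𝓝 x₀) := (continuous_snd.tendsto _).comp htend
    filter_upwards [htend.eventually hmax, htend'.eventually hΨψ, Icc_mem_nhdsLT ht₀] with s h1 h2 hs
    have h3 := value_le_integral_add_value hP hι hφ hs.1 hs.2 (hγ.mono_right hs.1 hs.2)
    rw [hx] at h3
    have h4 := hΨψ.self_of_nhds t₀
    simp only [Pi.add_apply, Function.comp_apply, hx, intervalIntegral.integral_same, add_zero,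
      h2 s, h4] at h1 ⊢
    linarith

/-- If the operator were negative, `L - ψ_t - ψ_x f` would exceed a positive `θ` near `(t₀, x₀)`,
uniformly in `u`. Integrated along an almost optimal trajectory on an interval of length `h`, this
gains `θ * h`, against an optimality defect of `θ * h / 2`. Controls are unbounded, so staying near
`x₀` and the linearisation error both need care. -/
theorem value_supersolution (hφ : ∃ B, ∀ x, |φ x| ≤ B) {ψ : ℝ → M → ℝ}
    (hψ : ContMDiff (𝓘(ℝ, ℝ).prod 𝓘(ℝ, EuclideanSpace ℝ (Fin n))) 𝓘(ℝ, ℝ) 1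
      (fun z : ℝ × M => ψ z.1 z.2)) {t₀ : ℝ} {x₀ : M} (ht₀ : 0 < t₀)
    (hmin : IsLocalMin (fun z : ℝ × M => P.value ι φ z.1 z.2 - ψ z.1 z.2) (t₀, x₀)) :
    0 ≤ P.hjOperator ψ t₀ x₀ := by
  obtain ⟨Ψ, Ψ', hΨ, hΨψ, hd, hq⟩ :=
    exists_ambient_extension (hι.isImmersion.isImmersionAt x₀) hψ t₀
  have hιc := hι.isEmbedding.continuous
  by_contra! hneg
  set q : EuclideanSpace ℝ (Fin N) →L[ℝ] ℝ := Ψ'.comp (ContinuousLinearMap.inr ℝ ℝ _) with hqdef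
  set d : ℝ := Ψ' (1, 0) with hddef
  have hsplit : ∀ (τ : ℝ) (w : EuclideanSpace ℝ (Fin N)), Ψ' (τ, w) = τ * d + q w := fun τ w => by
    have : ((τ, w) : ℝ × EuclideanSpace ℝ (Fin N)) = τ • ((1 : ℝ), (0 : EuclideanSpace ℝ (Fin N))) +
      (0, w) := by simp
    rw [this, map_add, map_smul, smul_eq_mul]
    rfl
  set θ := -P.hjOperator ψ t₀ x₀ / 3 with hθdef
  have hθ : 0 < θ := by rw [hθdef]; linarith
  have hG : ∀ u ∈ P.U, 3 * θ ≤ P.L t₀ x₀ u - d - q (P.ambient ι x₀ u) := fun u hu => by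
    have h1 := le_csSup (hP.bddAbove_hamiltonian hιc ht₀.le x₀ q) ⟨u, hu, rfl⟩
    have h2 : 3 * θ = -P.hjOperator ψ t₀ x₀ := by rw [hθdef]; ring
    rw [hjOperator_eq (q := q) hq, hd] at h2
    simp only at h1
    linarith
  obtain ⟨η, hη, hev⟩ := hP.eventually_forall_le hιc ht₀ x₀ q hθ hG
  -- The linearisation error is at most `η * (h + ∫ ‖f‖)` along the trajectory, exactly what the
  -- term `η * (1 + ‖f‖)` in `hev` compensates.
  have hdiff : ∀ᶠ z : ℝ × M in 𝓝 (t₀, x₀),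
      |Ψ (z.1, ι z.2) - Ψ (t₀, ι x₀) - Ψ' (z.1 - t₀, ι z.2 - ι x₀)| ≤
        η * ‖((z.1 - t₀, ι z.2 - ι x₀) : ℝ × EuclideanSpace ℝ (Fin N))‖ := by
    have h1 := hΨ.isLittleO.def hη
    have h2 : Tendsto (fun z : ℝ × M => (z.1, ι z.2)) (𝓝 (t₀, x₀)) (𝓝 (t₀, ι x₀)) :=
      Continuous.tendsto (by fun_prop) _
    exact h2.eventually h1
  have hψev : ∀ᶠ z : ℝ × M in 𝓝 (t₀, x₀), ∀ t, Ψ (t, ι z.2) = ψ t z.2 :=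
    (continuous_snd.tendsto (t₀, x₀)).eventually hΨψ
  let : MetricSpace M := hι.isEmbedding.comapMetricSpace ι
  obtain ⟨r, hr, hball⟩ := Metric.eventually_nhds_iff.1 (((hev.and hdiff).and hψev).and hmin)
  obtain ⟨B, hB0, hB⟩ := exists_abs_value_le hP hι hφ t₀
  obtain ⟨K, hK0, hK⟩ := hP.exists_norm_ambient_le hιc
  -- The slope is chosen after the radius `r`, so that `(K + 1) * ∫ ‖v‖ ≤ r / 3`: a large slope
  -- makes the control small in `L¹`.
  set k := 3 * (K + 1) * (2 * B + 2) / r with hk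
  obtain ⟨C, hC0, hC⟩ := hP.exists_le_cost t₀ k
  have hk0 : 0 < k := by positivity
  -- The three bounds keep the initial time nonnegative, limit the elapsed time and its drift to `r
  -- / 3`, and make `θ * h + C * h` at most `1` in the energy estimate.
  set h := min t₀ (min (r / (3 * (K + 1))) (1 / (θ + C + 1))) with hh
  have hh0 : 0 < h := by positivity
  have hht : h ≤ t₀ := min_le_left _ _
  have hhr : (K + 1) * h ≤ r / 3 := by
    have : h ≤ r / (3 * (K + 1)) := (min_le_right _ _).trans (min_le_left _ _)
    calc (K + 1) * h ≤ (K + 1) * (r / (3 * (K + 1))) := by gcongr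
      _ = r / 3 := by field_simp
  have hhC : (θ + C) * h ≤ 1 := by
    have : h ≤ 1 / (θ + C + 1) := (min_le_right _ _).trans (min_le_right _ _)
    calc (θ + C) * h ≤ (θ + C + 1) * (1 / (θ + C + 1)) :=
          mul_le_mul (by linarith) this hh0.le (by positivity)
      _ = 1 := by field_simp
  set a := t₀ - h with ha
  have ha0 : 0 ≤ a := by linarith
  have hat : a ≤ t₀ := by linarith
  obtain ⟨v, γ, hγ, hx, hle⟩ := exists_integral_add_value_le hP hι hφ ha0 hat x₀
    (ε := θ * h / 2) (by positivity)
  have hcontrol : (K + 1) * ∫ s in a..t₀, ‖(v s : EuclideanSpace ℝ (Fin m))‖ ≤ r / 3 := by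
    have h1 := hγ.le_integral_cost hC ha0 hat le_rfl
    have h2 := le_of_abs_le (hB t₀ ⟨ht₀.le, le_rfl⟩ x₀)
    have h3 := neg_le_of_abs_le (hB a ⟨ha0, hat⟩ (γ a))
    have h4 : t₀ - a = h := by rw [ha]; ring
    rw [h4] at h1
    have h5 : k * (∫ s in a..t₀, ‖(v s : EuclideanSpace ℝ (Fin m))‖) ≤ 2 * B + 2 := by
      have : 0 ≤ θ * h := by positivity
      linarith
    have h6 : (∫ s in a..t₀, ‖(v s : EuclideanSpace ℝ (Fin m))‖) ≤ (2 * B + 2) / k :=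
      (le_div_iff₀' hk0).2 h5
    calc _ ≤ (K + 1) * ((2 * B + 2) / k) := by gcongr
      _ = r / 3 := by rw [hk]; field_simp
  have hnear : ∀ s ∈ Icc a t₀, dist (s, γ s) (t₀, x₀) < r := fun s hs => by
    have h1 := (hγ.toIsSolution.mono_right hs.1 hs.2).norm_displacement_le hK hs.2
    have h2 : ∫ r in s..t₀, ‖(v r : EuclideanSpace ℝ (Fin m))‖ ≤
        ∫ r in a..t₀, ‖(v r : EuclideanSpace ℝ (Fin m))‖ := by
      rw [← intervalIntegral.integral_add_adjacent_intervals
        (hγ.mono_left hs.1 hs.2).control (hγ.mono_right hs.1 hs.2).control]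
      have : 0 ≤ ∫ r in a..s, ‖(v r : EuclideanSpace ℝ (Fin m))‖ :=
        intervalIntegral.integral_nonneg hs.1 fun r _ => norm_nonneg _
      linarith
    have h3 : 0 ≤ ∫ r in a..t₀, ‖(v r : EuclideanSpace ℝ (Fin m))‖ :=
      intervalIntegral.integral_nonneg hat fun r _ => norm_nonneg _
    have h4 : t₀ - s ≤ h := by have := hs.1; rw [ha] at this; linarith
    have h5 : K * ((t₀ - s) + ∫ r in s..t₀, ‖(v r : EuclideanSpace ℝ (Fin m))‖) ≤
        (K + 1) * (h + ∫ r in a..t₀, ‖(v r : EuclideanSpace ℝ (Fin m))‖) :=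
      mul_le_mul (by linarith) (add_le_add h4 h2)
        (add_nonneg (by linarith [hs.2]) (intervalIntegral.integral_nonneg hs.2 fun r _ => norm_nonneg _))
        (by linarith)
    have h6 : dist (γ s) x₀ = ‖ι (γ t₀) - ι (γ s)‖ := by
      rw [norm_sub_rev, hx]; exact dist_eq_norm (ι (γ s)) (ι x₀)
    rw [Prod.dist_eq, max_lt_iff]
    constructor
    · have h7 : h ≤ (K + 1) * h := le_mul_of_one_le_left hh0.le (by linarith)
      rw [Real.dist_eq, abs_sub_comm, abs_of_nonneg (by linarith [hs.2])]
      linarith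
    · rw [h6]; linarith
  obtain ⟨⟨⟨-, h1⟩, h2⟩, h3⟩ := hball (hnear a (left_mem_Icc.2 hat))
  have hE : ι x₀ - ι (γ a) = ∫ s in a..t₀, P.ambient ι (γ s) (v s) := by
    rw [hγ.eq a (left_mem_Icc.2 hat), hx, sub_sub_cancel]
  have hnormE : ‖ι x₀ - ι (γ a)‖ ≤ ∫ s in a..t₀, ‖P.ambient ι (γ s) (v s)‖ := by
    rw [hE]; exact intervalIntegral.norm_integral_le_integral_norm hat
  have hqE : q (ι x₀ - ι (γ a)) = ∫ s in a..t₀, q (P.ambient ι (γ s) (v s)) := by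
    rw [hE, ContinuousLinearMap.intervalIntegral_comp_comm _ hγ.speed]
  have hqi : IntervalIntegrable (fun s => q (P.ambient ι (γ s) (v s))) volume a t₀ :=
    ⟨q.integrable_comp hγ.speed.1, q.integrable_comp hγ.speed.2⟩
  have hni : IntervalIntegrable (fun s => η * (1 + ‖P.ambient ι (γ s) (v s)‖)) volume a t₀ :=
    (intervalIntegrable_const.add hγ.speed.norm).const_mul η
  have hint : ∫ _s in a..t₀, θ ≤ ∫ s in a..t₀, (P.L s (γ s) (v s) - d -
      q (P.ambient ι (γ s) (v s)) - η * (1 + ‖P.ambient ι (γ s) (v s)‖)) :=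
    intervalIntegral.integral_mono_on hat intervalIntegrable_const
      (((hγ.cost.sub intervalIntegrable_const).sub hqi).sub hni)
      fun s hs => (hball (hnear s hs)).1.1.1 (v s) (v s).2
  rw [intervalIntegral.integral_sub ((hγ.cost.sub intervalIntegrable_const).sub hqi) hni,
    intervalIntegral.integral_sub (hγ.cost.sub intervalIntegrable_const) hqi,
    intervalIntegral.integral_sub hγ.cost intervalIntegrable_const,
    intervalIntegral.integral_const_mul, intervalIntegral.integral_add intervalIntegrable_const
      hγ.speed.norm, ← hqE] at hint
  have hta : t₀ - a = h := by rw [ha]; ring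
  simp only [intervalIntegral.integral_const, smul_eq_mul, mul_one, hta] at hint
  have h4 := hΨψ.self_of_nhds t₀
  have h5 : ‖((a - t₀, ι (γ a) - ι x₀) : ℝ × EuclideanSpace ℝ (Fin N))‖ ≤
      h + ‖ι x₀ - ι (γ a)‖ := by
    rw [Prod.norm_def]
    refine max_le ?_ ?_
    · have : ‖a - t₀‖ = h := by rw [norm_sub_rev, hta, Real.norm_of_nonneg hh0.le]
      simp only [this]
      linarith [norm_nonneg (ι x₀ - ι (γ a))]
    · simp only [norm_sub_rev (ι (γ a))]
      linarith
  have h6 := (neg_le_of_abs_le h1)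
  have h6' := (le_of_abs_le h1)
  rw [hsplit] at h6 h6'
  have h7 : q (ι (γ a) - ι x₀) = -q (ι x₀ - ι (γ a)) := by rw [← map_neg, neg_sub]
  have h8 : a - t₀ = -h := by linarith
  have h9 := mul_le_mul_of_nonneg_left h5 hη.le
  have h10 := mul_le_mul_of_nonneg_left hnormE hη.le
  simp only [h2 a, h4, h7, h8] at h6 h6' h3 h9
  have : 0 < θ * h := by positivity
  linarith

end
end ControlProblem

/-! ### The comparison principle -/

namespace ControlProblem

section
variable {n m N : ℕ} {M : Type*} [TopologicalSpace M]
  [ChartedSpace (EuclideanSpace ℝ (Fin n)) M]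
  {P : ControlProblem n m M} {ι : M → EuclideanSpace ℝ (Fin N)} {t : ℝ} {x : M}

/-- The doubling penalties, with one pair of variables frozen, have this form; they are globally
`C¹`, so no cutoff is needed. -/
theorem contMDiff_separated (hι : ContMDiff 𝓘(ℝ, EuclideanSpace ℝ (Fin n))
      𝓘(ℝ, EuclideanSpace ℝ (Fin N)) ∞ ι) {g : ℝ → ℝ} {b : EuclideanSpace ℝ (Fin N) → ℝ}
    (hg : ContDiff ℝ 1 g) (hb : ContDiff ℝ 1 b) :
    ContMDiff (𝓘(ℝ, ℝ).prod 𝓘(ℝ, EuclideanSpace ℝ (Fin n))) 𝓘(ℝ, ℝ) 1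
      (fun z : ℝ × M => g z.1 + b (ι z.2)) :=
  (hg.contMDiff.comp contMDiff_fst).add
    (hb.contMDiff.comp ((hι.of_le (by simp)).comp contMDiff_snd))

theorem hjOperator_separated (hι : ContMDiff 𝓘(ℝ, EuclideanSpace ℝ (Fin n))
      𝓘(ℝ, EuclideanSpace ℝ (Fin N)) ∞ ι) {g : ℝ → ℝ} {b : EuclideanSpace ℝ (Fin N) → ℝ} {g' : ℝ}
    {q : EuclideanSpace ℝ (Fin N) →L[ℝ] ℝ} (hg : HasDerivAt g g' t) (hb : HasFDerivAt b q (ι x)) :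
    P.hjOperator (fun t x => g t + b (ι x)) t x =
      g' + sSup ((fun u => q (P.ambient ι x u) - P.L t x u) '' P.U) := by
  rw [hjOperator_eq (q := q) (ι := ι), (hg.add_const _).deriv]
  intro w
  have h1 := ((hb.const_add (g t)).hasMFDerivAt.comp x
    (hι.contMDiffAt.mdifferentiableAt (x := x) (by simp)).hasMFDerivAt).mfderiv
  exact congrArg (fun T : EuclideanSpace ℝ (Fin n) →L[ℝ] ℝ => T w) h1

variable [CompactSpace M]

/-- Uniform continuity of the Hamiltonian for bounded momenta. -/
theorem Regular.exists_hamiltonian_sub_lt (hP : P.Regular ι) (hι : Topology.IsEmbedding ι)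
    (T Λ : ℝ) {c : ℝ} (hc : 0 < c) :
    ∃ δ, 0 < δ ∧ ∀ s ∈ Icc 0 T, ∀ t ∈ Icc 0 T, ∀ x y, ∀ q : EuclideanSpace ℝ (Fin N) →L[ℝ] ℝ,
      ‖q‖ ≤ Λ → |t - s| < δ → ‖ι x - ι y‖ < δ →
      sSup ((fun u => q (P.ambient ι y u) - P.L s y u) '' P.U) <
        sSup ((fun u => q (P.ambient ι x u) - P.L t x u) '' P.U) + c := by
  obtain ⟨C, hC0, hC⟩ := hP.exists_mul_norm_ambient_sub_le hι.continuous T Λ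
  obtain ⟨K, hK0, hK⟩ := hP.exists_norm_ambient_le hι.continuous
  obtain ⟨u₀, hu₀⟩ := hP.nonempty
  obtain ⟨D, hD0, hD⟩ := hP.exists_cost_le hu₀ T
  -- A control within `c / 3` of the supremum does at least as well as `u₀` up to `c / 3`;
  -- coercivity then bounds its norm by `R`.
  set R := C + |Λ| * (K * (1 + ‖u₀‖)) + D + c / 3 with hR
  let : MetricSpace M := hι.comapMetricSpace ι
  have hcpt : IsCompact {u : P.U | ‖(u : EuclideanSpace ℝ (Fin m))‖ ≤ R} := by
    have := hP.isClosed.isClosedEmbedding_subtypeVal.isCompact_preimage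
      (isCompact_closedBall (0 : EuclideanSpace ℝ (Fin m)) R)
    simpa [preimage, Metric.closedBall] using this
  have hK' := (isCompact_Icc (a := 0) (b := T)).prod ((isCompact_univ (X := M)).prod hcpt)
  have hG : Continuous fun z : ℝ × M × P.U =>
      (P.L (max z.1 0) z.2.1 z.2.2, P.ambient ι z.2.1 z.2.2) :=
    hP.continuous_cost.prodMk (hP.continuous_ambient.comp continuous_snd)
  -- With this tolerance the change of `L` plus `Λ` times the change of `f` is at most `c / 3`.
  obtain ⟨δ, hδ, huc⟩ := Metric.uniformContinuousOn_iff.1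
    (hK'.uniformContinuousOn_of_continuous hG.continuousOn) (c / (3 * (|Λ| + 1))) (by positivity)
  refine ⟨δ, hδ, fun s hs t ht x y q hq hts hxy => ?_⟩
  have hbdd := hP.bddAbove_hamiltonian hι.continuous hs.1 y q
  have hbdd' := hP.bddAbove_hamiltonian hι.continuous ht.1 x q
  obtain ⟨_, ⟨u, hu, rfl⟩, hu'⟩ := exists_lt_of_lt_csSup (hP.nonempty.image
    (fun u => q (P.ambient ι y u) - P.L s y u)) (sub_lt_self _ (show 0 < c / 3 by positivity))
  have h0 : q (P.ambient ι y u₀) - P.L s y u₀ ≤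
      sSup ((fun u => q (P.ambient ι y u) - P.L s y u) '' P.U) := le_csSup hbdd ⟨u₀, hu₀, rfl⟩
  have hqΛ : ∀ w, |q w| ≤ Λ * ‖w‖ := fun w =>
    (q.le_opNorm w).trans (mul_le_mul_of_nonneg_right hq (norm_nonneg w))
  have hΛ0 : 0 ≤ Λ := (norm_nonneg q).trans hq
  have huR : ‖u‖ ≤ R := by
    have h1 := hC s hs y u hu
    have h2 := le_of_abs_le (hqΛ (P.ambient ι y u))
    have h3 := neg_le_of_abs_le (hqΛ (P.ambient ι y u₀))
    have h4 := mul_le_mul_of_nonneg_left (hK y u₀ hu₀) hΛ0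
    have h5 := hD s hs y
    rw [hR, abs_of_nonneg hΛ0]
    simp only at hu'
    linarith
  have h1 := huc (s, y, ⟨u, hu⟩) ⟨hs, mem_univ _, huR⟩ (t, x, ⟨u, hu⟩) ⟨ht, mem_univ _, huR⟩ (by
    rw [Prod.dist_eq, Prod.dist_eq, dist_self]
    refine max_lt ?_ (max_lt ?_ hδ)
    · rw [dist_comm]; exact hts
    · rw [dist_comm]; exact (dist_eq_norm (ι x) (ι y)).trans_lt hxy)
  rw [Prod.dist_eq, max_lt_iff] at h1
  simp only [max_eq_left hs.1, max_eq_left ht.1, dist_eq_norm] at h1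
  have h2 := (abs_lt.1 h1.1).1
  have h3 := hqΛ (P.ambient ι y u - P.ambient ι x u)
  rw [map_sub] at h3
  have h4 : Λ * ‖P.ambient ι y u - P.ambient ι x u‖ ≤ Λ * (c / (3 * (|Λ| + 1))) :=
    mul_le_mul_of_nonneg_left h1.2.le hΛ0
  have h5 : (Λ + 1) * (c / (3 * (|Λ| + 1))) = c / 3 := by
    rw [abs_of_nonneg hΛ0]; field_simp
  have h6 := le_of_abs_le h3
  have h7 : q (P.ambient ι x u) - P.L t x u ≤
      sSup ((fun u => q (P.ambient ι x u) - P.L t x u) '' P.U) := le_csSup hbdd' ⟨u, hu, rfl⟩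
  simp only at hu'
  linarith

/-- `A` is a viscosity subsolution of the Hamilton–Jacobi equation for positive times. -/
def IsSubsolution (P : ControlProblem n m M) (A : ℝ → M → ℝ) : Prop :=
  ∀ ψ : ℝ → M → ℝ,
    ContMDiff (𝓘(ℝ, ℝ).prod 𝓘(ℝ, EuclideanSpace ℝ (Fin n))) 𝓘(ℝ, ℝ) 1
      (fun z : ℝ × M => ψ z.1 z.2) →
    ∀ t₀ x₀, 0 < t₀ → IsLocalMax (fun z : ℝ × M => A z.1 z.2 - ψ z.1 z.2) (t₀, x₀) →
      P.hjOperator ψ t₀ x₀ ≤ 0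

/-- `B` is a viscosity supersolution of the Hamilton–Jacobi equation for positive times. -/
def IsSupersolution (P : ControlProblem n m M) (B : ℝ → M → ℝ) : Prop :=
  ∀ ψ : ℝ → M → ℝ,
    ContMDiff (𝓘(ℝ, ℝ).prod 𝓘(ℝ, EuclideanSpace ℝ (Fin n))) 𝓘(ℝ, ℝ) 1
      (fun z : ℝ × M => ψ z.1 z.2) →
    ∀ t₀ x₀, 0 < t₀ → IsLocalMin (fun z : ℝ × M => B z.1 z.2 - ψ z.1 z.2) (t₀, x₀) →
      0 ≤ P.hjOperator ψ t₀ x₀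

theorem exists_uniform_modulus (hι : Topology.IsEmbedding ι) {A : ℝ → M → ℝ}
    (hA : ContinuousOn (fun z : ℝ × M => A z.1 z.2) (Ici 0 ×ˢ univ)) (T : ℝ) {ε : ℝ} (hε : 0 < ε) :
    ∃ δ, 0 < δ ∧ ∀ s ∈ Icc 0 T, ∀ t ∈ Icc 0 T, ∀ x y, |t - s| < δ → ‖ι x - ι y‖ < δ →
      |A t x - A s y| < ε := by
  let : MetricSpace M := hι.comapMetricSpace ι
  have hK := (isCompact_Icc (a := 0) (b := T)).prod (isCompact_univ (X := M))
  obtain ⟨δ, hδ, h⟩ := Metric.uniformContinuousOn_iff.1 (hK.uniformContinuousOn_of_continuous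
    (hA.mono (prod_mono Icc_subset_Ici_self Subset.rfl))) ε hε
  refine ⟨δ, hδ, fun s hs t ht x y hts hxy => ?_⟩
  refine h (t, x) ⟨ht, mem_univ _⟩ (s, y) ⟨hs, mem_univ _⟩ ?_
  rw [Prod.dist_eq]
  exact max_lt hts ((dist_eq_norm (ι x) (ι y)).trans_lt hxy)

/-- Comparison principle, when one of the two functions is Lipschitz in space. -/
theorem comparison (hP : P.Regular ι) (hι : Manifold.IsSmoothEmbedding
      𝓘(ℝ, EuclideanSpace ℝ (Fin n)) 𝓘(ℝ, EuclideanSpace ℝ (Fin N)) ∞ ι) {A B : ℝ → M → ℝ}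
    (hAc : ContinuousOn (fun z : ℝ × M => A z.1 z.2) (Ici 0 ×ˢ univ))
    (hBc : ContinuousOn (fun z : ℝ × M => B z.1 z.2) (Ici 0 ×ˢ univ))
    (hA : P.IsSubsolution A) (hB : P.IsSupersolution B) (h0 : ∀ x, A 0 x ≤ B 0 x)
    {T Λ : ℝ} (hT : 0 ≤ T)
    (hL : (∀ t ∈ Icc 0 (T + 2), ∀ x y, |A t x - A t y| ≤ Λ * ‖ι x - ι y‖) ∨
      (∀ t ∈ Icc 0 (T + 2), ∀ x y, |B t x - B t y| ≤ Λ * ‖ι x - ι y‖)) (x : M) :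
    A T x ≤ B T x := by
  by_contra! hlt
  have hιc := hι.isEmbedding.continuous
  set σ := A T x - B T x with hσ
  have hσ0 : 0 < σ := sub_pos.2 hlt
  have hcI := (isCompact_Icc (a := 0) (b := T + 2)).prod (isCompact_univ (X := M))
  have hsub : Icc 0 (T + 2) ×ˢ (univ : Set M) ⊆ Ici 0 ×ˢ univ :=
    prod_mono Icc_subset_Ici_self Subset.rfl
  obtain ⟨CA, hCA⟩ := (hcI.image_of_continuousOn (hAc.mono hsub).norm).bddAbove
  obtain ⟨CB, hCB⟩ := (hcI.image_of_continuousOn (hBc.mono hsub).norm).bddAbove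
  have hCA' : ∀ t ∈ Icc 0 (T + 2), ∀ x, A t x ≤ |CA| := fun t ht x =>
    (le_abs_self _).trans ((hCA ⟨(t, x), ⟨ht, mem_univ _⟩, rfl⟩ : ‖A t x‖ ≤ CA).trans
      (le_abs_self _))
  have hCB' : ∀ t ∈ Icc 0 (T + 2), ∀ x, -B t x ≤ |CB| := fun t ht x =>
    (neg_le_abs _).trans ((hCB ⟨(t, x), ⟨ht, mem_univ _⟩, rfl⟩ : ‖B t x‖ ≤ CB).trans
      (le_abs_self _))
  set C := |CA| + |CB| + 1 with hC
  have hC0 : 0 < C := by positivity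
  -- Half the supposed gap, so that `Φ` still equals `η` at the doubled point `(T, x)`.
  set η := σ / 2 with hη
  have hη0 : 0 < η := by positivity
  -- Then `η * exp μ ≥ C`: from time `T + 1` on the penalty outweighs `A - B`. With `|t - s| < 1`
  -- both times of the maximum stay below `T + 2`.
  set μ := C / η with hμ
  have hμ0 : 0 < μ := by positivity
  have hμC : C ≤ η * Real.exp μ := by
    have h1 := Real.add_one_le_exp μ
    calc C = η * μ := by rw [hμ]; field_simp
      _ ≤ η * Real.exp μ := by gcongr; linarith
  -- The least time derivative of the exponential penalty on `[0, T + 2]`: the strict gain behind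
  -- the contradiction.
  set c := η * (μ * Real.exp (μ * (0 - T))) with hc
  have hc0 : 0 < c := by positivity
  obtain ⟨δ₁, hδ₁, hmodA⟩ := exists_uniform_modulus hι.isEmbedding hAc (T + 2) hη0
  obtain ⟨δ₂, hδ₂, hmodB⟩ := exists_uniform_modulus hι.isEmbedding hBc (T + 2) hη0
  obtain ⟨δ₃, hδ₃, hmodH⟩ := hP.exists_hamiltonian_sub_lt hι.isEmbedding (T + 2) (2 * |Λ|) hc0
  set δ := min (min δ₁ δ₂) (min δ₃ 1) with hδ
  have hδ0 : 0 < δ := by positivity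
  have hδ1 : δ ≤ δ₁ := (min_le_left _ _).trans (min_le_left _ _)
  have hδ2 : δ ≤ δ₂ := (min_le_left _ _).trans (min_le_right _ _)
  have hδ3 : δ ≤ δ₃ := (min_le_right _ _).trans (min_le_left _ _)
  have hδ4 : δ ≤ 1 := (min_le_right _ _).trans (min_le_right _ _)
  -- At the maximum each quadratic penalty is below `C`, which with this `ε` forces the distance
  -- below `δ`.
  set ε := δ ^ 2 / (4 * C) with hε
  have hε0 : 0 < ε := by positivity
  let Φ : (ℝ × M) × (ℝ × M) → ℝ := fun z => A z.1.1 z.1.2 - B z.2.1 z.2.2 -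
    ‖ι z.1.2 - ι z.2.2‖ ^ 2 / (2 * ε) - (z.1.1 - z.2.1) ^ 2 / (2 * ε) -
    η * Real.exp (μ * (z.1.1 - T))
  have hΦc : ContinuousOn Φ ((Icc 0 (T + 2) ×ˢ univ) ×ˢ (Icc 0 (T + 2) ×ˢ univ)) := by
    have h1 := (hAc.mono hsub).comp (t := Icc 0 (T + 2) ×ˢ univ) (f := Prod.fst)
      (s := (Icc 0 (T + 2) ×ˢ univ) ×ˢ (Icc 0 (T + 2) ×ˢ (univ : Set M))) continuousOn_fst
      fun z hz => hz.1
    have h2 := (hBc.mono hsub).comp (t := Icc 0 (T + 2) ×ˢ univ) (f := Prod.snd)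
      (s := (Icc 0 (T + 2) ×ˢ (univ : Set M)) ×ˢ (Icc 0 (T + 2) ×ˢ (univ : Set M))) continuousOn_snd
      fun z hz => hz.2
    have h3 : Continuous fun z : (ℝ × M) × (ℝ × M) => ‖ι z.1.2 - ι z.2.2‖ ^ 2 / (2 * ε) := by
      fun_prop
    have h4 : Continuous fun z : (ℝ × M) × (ℝ × M) => (z.1.1 - z.2.1) ^ 2 / (2 * ε) := by
      fun_prop
    have h5 : Continuous fun z : (ℝ × M) × (ℝ × M) => η * Real.exp (μ * (z.1.1 - T)) := by
      fun_prop
    exact (((h1.sub h2).sub h3.continuousOn).sub h4.continuousOn).sub h5.continuousOn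
  have hTmem : T ∈ Icc 0 (T + 2) := ⟨hT, by linarith⟩
  obtain ⟨⟨⟨t, x₁⟩, ⟨s, x₂⟩⟩, ⟨⟨ht, -⟩, ⟨hs, -⟩⟩, hmax⟩ := (hcI.prod hcI).exists_isMaxOn
    ⟨((T, x), (T, x)), ⟨hTmem, mem_univ _⟩, ⟨hTmem, mem_univ _⟩⟩ hΦc
  have hmax' : ∀ t' ∈ Icc 0 (T + 2), ∀ s' ∈ Icc 0 (T + 2), ∀ x' y',
      Φ ((t', x'), (s', y')) ≤ Φ ((t, x₁), (s, x₂)) := fun t' ht' s' hs' x' y' =>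
    hmax (show ((t', x'), (s', y')) ∈ _ from ⟨⟨ht', mem_univ _⟩, ⟨hs', mem_univ _⟩⟩)
  have hbase : η ≤ Φ ((t, x₁), (s, x₂)) := by
    refine le_trans (le_of_eq ?_) (hmax' T hTmem T hTmem x x)
    simp only [Φ, sub_self, norm_zero, mul_zero, Real.exp_zero, mul_one]
    rw [← hσ, hη]
    ring
  have hpen := mul_pos hη0 (Real.exp_pos (μ * (t - T)))
  have hsq1 : 0 ≤ ‖ι x₁ - ι x₂‖ ^ 2 / (2 * ε) := by positivity
  have hsq2 : 0 ≤ (t - s) ^ 2 / (2 * ε) := by positivity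
  have hA1 := hCA' t ht x₁
  have hB1 := hCB' s hs x₂
  simp only [Φ] at hbase
  have hclose : ∀ r : ℝ, 0 ≤ r → r ^ 2 / (2 * ε) < C → r < δ := fun r hr h => by
    rw [div_lt_iff₀ (by positivity), hε] at h
    have h1 : r ^ 2 < δ ^ 2 := by
      refine h.trans ?_
      have : C * (2 * (δ ^ 2 / (4 * C))) = δ ^ 2 / 2 := by field_simp; ring
      rw [this]
      exact half_lt_self (by positivity)
    exact lt_of_pow_lt_pow_left₀ 2 hδ0.le h1
  have hts : |t - s| < δ := hclose _ (abs_nonneg _) (by rw [sq_abs]; linarith)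
  have hx12 : ‖ι x₁ - ι x₂‖ < δ := hclose _ (norm_nonneg _) (by linarith)
  have htT : t < T + 1 := by
    by_contra! h
    have h1 : η * Real.exp μ ≤ η * Real.exp (μ * (t - T)) := by
      gcongr
      exact le_mul_of_one_le_right hμ0.le (by linarith)
    linarith
  have hsT : s < T + 2 := by
    have := (abs_lt.1 hts).1
    linarith
  -- At `t = 0` the initial inequality and the modulus of `B` would make `A - B` less than `η`,
  -- against `hbase`. The case `s = 0` uses the modulus of `A`.
  have ht0 : 0 < t := by
    refine lt_of_le_of_ne ht.1 fun h => ?_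
    subst h
    have h1 := hmodB s hs 0 ht x₁ x₂ (hts.trans_le hδ2) (hx12.trans_le hδ2)
    have h2 := (abs_lt.1 h1).2
    have h3 := h0 x₁
    linarith
  have hs0 : 0 < s := by
    refine lt_of_le_of_ne hs.1 fun h => ?_
    subst h
    have h1 := hmodA 0 hs t ht x₁ x₂ (hts.trans_le hδ1) (hx12.trans_le hδ1)
    have h2 := (abs_lt.1 h1).2
    have h3 := h0 x₂
    linarith
  -- Moving the point of the Lipschitz function onto the other one removes the spatial penalty and
  -- changes `A - B` by at most `|Λ|` times the distance. Hence the momentum `(ι x₁ - ι x₂) / ε` is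
  -- bounded by `2 * |Λ|`, independently of `ε`.
  have hlip : ‖ι x₁ - ι x₂‖ ^ 2 / (2 * ε) ≤ |Λ| * ‖ι x₁ - ι x₂‖ := by
    have hΛ : Λ * ‖ι x₁ - ι x₂‖ ≤ |Λ| * ‖ι x₁ - ι x₂‖ := by gcongr; exact le_abs_self _
    rcases hL with hL | hL
    · have h1 := hmax' t ht s hs x₂ x₂
      have h2 := le_of_abs_le (hL t ht x₁ x₂)
      simp only [Φ, sub_self, norm_zero] at h1
      norm_num at h1
      linarith
    · have h1 := hmax' t ht s hs x₁ x₁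
      have h2 := le_of_abs_le (hL s hs x₁ x₂)
      simp only [Φ, sub_self, norm_zero] at h1
      norm_num at h1
      linarith
  set q : EuclideanSpace ℝ (Fin N) →L[ℝ] ℝ := innerSL ℝ (ε⁻¹ • (ι x₁ - ι x₂)) with hq
  have hqn : ‖q‖ ≤ 2 * |Λ| := by
    rw [hq, innerSL_apply_norm, norm_smul, norm_inv, Real.norm_of_nonneg hε0.le]
    rcases (norm_nonneg (ι x₁ - ι x₂)).eq_or_lt with h | h
    · rw [← h]; simp
    · rw [div_le_iff₀ (by positivity), sq] at hlip
      have h1 : ‖ι x₁ - ι x₂‖ ≤ |Λ| * (2 * ε) := by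
        refine le_of_mul_le_mul_right ?_ h
        linarith
      rw [inv_mul_le_iff₀ hε0]
      linarith
  have hfd : ∀ z w : EuclideanSpace ℝ (Fin N), HasFDerivAt (fun v => ‖v - z‖ ^ 2 / (2 * ε))
      (innerSL ℝ (ε⁻¹ • (w - z))) w := fun z w => by
    have h1 := (((hasFDerivAt_id (𝕜 := ℝ) w).sub_const z).norm_sq).mul_const (2 * ε)⁻¹
    simp only [← div_eq_mul_inv] at h1
    refine h1.congr_fderiv ?_
    ext v
    simp
    field_simp
  have hsubt := hA (fun t' x' => ((t' - s) ^ 2 / (2 * ε) + η * Real.exp (μ * (t' - T))) +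
      ‖ι x' - ι x₂‖ ^ 2 / (2 * ε))
    (contMDiff_separated hι.contMDiff (g := fun t' => (t' - s) ^ 2 / (2 * ε) +
      η * Real.exp (μ * (t' - T))) (b := fun w => ‖w - ι x₂‖ ^ 2 / (2 * ε)) (by fun_prop)
      (((contDiff_id.sub contDiff_const).norm_sq ℝ).div_const _)) t x₁ ht0 (by
    have h1 : ∀ᶠ z : ℝ × M in 𝓝 (t, x₁), z.1 ∈ Icc 0 (T + 2) :=
      continuous_fst.continuousAt.eventually_mem (Icc_mem_nhds ht0 (by simp only; linarith))
    filter_upwards [h1] with z hz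
    have h2 := hmax' z.1 hz s hs z.2 x₂
    simp only [Φ] at h2
    linarith)
  have hsupt := hB (fun s' y' => -((s' - t) ^ 2 / (2 * ε)) + -(‖ι y' - ι x₁‖ ^ 2 / (2 * ε)))
    (contMDiff_separated hι.contMDiff (g := fun s' => -((s' - t) ^ 2 / (2 * ε)))
      (b := fun w => -(‖w - ι x₁‖ ^ 2 / (2 * ε))) (by fun_prop)
      (((contDiff_id.sub contDiff_const).norm_sq ℝ).div_const _).neg) s x₂ hs0 (by
    have h1 : ∀ᶠ z : ℝ × M in 𝓝 (s, x₂), z.1 ∈ Icc 0 (T + 2) :=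
      continuous_fst.continuousAt.eventually_mem (Icc_mem_nhds hs0 hsT)
    filter_upwards [h1] with z hz
    have h2 := hmax' t ht z.1 hz x₁ z.2
    simp only [Φ] at h2
    rw [norm_sub_rev (ι z.2), norm_sub_rev (ι x₂), sub_sq_comm z.1, sub_sq_comm s]
    linarith)
  have hgd : HasDerivAt (fun t' => (t' - s) ^ 2 / (2 * ε) + η * Real.exp (μ * (t' - T)))
      ((t - s) / ε + η * (μ * Real.exp (μ * (t - T)))) t := by
    have h1 := (((hasDerivAt_id t).sub_const s).pow 2).div_const (2 * ε)
    have h2 := ((((hasDerivAt_id t).sub_const T).const_mul μ).exp).const_mul η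
    refine (h1.add h2).congr_deriv ?_
    simp
    field_simp
  have hgd' : HasDerivAt (fun s' => -((s' - t) ^ 2 / (2 * ε))) ((t - s) / ε) s := by
    have h1 := ((((hasDerivAt_id s).sub_const t).pow 2).div_const (2 * ε)).neg
    refine h1.congr_deriv ?_
    simp
    field_simp
    ring
  rw [hjOperator_separated hι.contMDiff hgd (hfd (ι x₂) (ι x₁))] at hsubt
  have hfd' : HasFDerivAt (fun w => -(‖w - ι x₁‖ ^ 2 / (2 * ε))) q (ι x₂) := by
    refine (hfd (ι x₁) (ι x₂)).neg.congr_fderiv ?_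
    rw [hq, ← map_neg, ← smul_neg, neg_sub]
  rw [hjOperator_separated hι.contMDiff hgd' hfd'] at hsupt
  -- The terms `(t - s) / ε` cancel and both inequalities carry the same `q`, so the penalty
  -- derivative, at least `c`, is bounded by a Hamiltonian difference less than `c`.
  have hH := hmodH s hs t ht x₁ x₂ q hqn (hts.trans_le hδ3) (hx12.trans_le hδ3)
  have hcc : c ≤ η * (μ * Real.exp (μ * (t - T))) := by
    rw [hc]; gcongr
  linarith

end
end ControlProblem

/-! ### Uniqueness and the semigroup -/

theorem ContinuousMap.exists_forall_abs_le {M : Type*} [TopologicalSpace M] [CompactSpace M]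
    (φ : C(M, ℝ)) : ∃ B, ∀ x, |φ x| ≤ B := by
  obtain ⟨B, hB⟩ := (isCompact_range φ.continuous.norm).bddAbove
  exact ⟨B, fun x => hB ⟨x, rfl⟩⟩

namespace ControlProblem

section
variable {n m N : ℕ} {M : Type*} [TopologicalSpace M] [CompactSpace M]
  [ChartedSpace (EuclideanSpace ℝ (Fin n)) M] [IsManifold 𝓘(ℝ, EuclideanSpace ℝ (Fin n)) ∞ M]
  {P : ControlProblem n m M} {ι : M → EuclideanSpace ℝ (Fin N)}
  (hP : P.Regular ι) (hι : Manifold.IsSmoothEmbedding 𝓘(ℝ, EuclideanSpace ℝ (Fin n))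
      𝓘(ℝ, EuclideanSpace ℝ (Fin N)) ∞ ι)
include hP hι

theorem isViscositySolution_value (φ : C(M, ℝ)) : P.IsViscositySolution φ (P.value ι φ) where
  continuousOn := continuousOn_value hP hι φ
  initial := fun x => by rw [value_zero hP hι φ φ.exists_forall_abs_le]
  subsolution := fun _ hψ _ _ ht h => value_subsolution hP hι φ.exists_forall_abs_le hψ ht h
  supersolution := fun _ hψ _ _ ht h => value_supersolution hP hι φ.exists_forall_abs_le hψ ht h

omit [CompactSpace M] [IsManifold 𝓘(ℝ, EuclideanSpace ℝ (Fin n)) ∞ M] hP hι in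
theorem IsViscositySolution.add_const {φ : M → ℝ} {W : ℝ → M → ℝ} (hW : P.IsViscositySolution φ W)
    (c : ℝ) : P.IsViscositySolution (fun x => φ x + c) (fun t x => W t x + c) where
  continuousOn := hW.continuousOn.add continuousOn_const
  initial := fun x => by rw [hW.initial]
  subsolution := fun ψ hψ t x ht h => hW.subsolution ψ hψ t x ht (by
    filter_upwards [h] with z hz
    linarith)
  supersolution := fun ψ hψ t x ht h => hW.supersolution ψ hψ t x ht (by
    filter_upwards [h] with z hz
    linarith)

/-- For merely continuous `φ` no Lipschitz bound is available on either side. A Lipschitz `χ` within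
`ε / 2` of `φ` gives a Lipschitz value function which, shifted by `± ε / 2`, encloses both `W` and
the value for `φ`; so these differ by at most `ε`. -/
theorem IsViscositySolution.eq_value {φ : C(M, ℝ)} {W : ℝ → M → ℝ}
    (hW : P.IsViscositySolution φ W) {t : ℝ} (ht : 0 ≤ t) (x : M) : W t x = P.value ι φ t x := by
  refine eq_of_forall_dist_le fun ε hε => ?_
  obtain ⟨φ', Λ, hΛ0, hΛ, hφ'⟩ := exists_lipschitz_approx hι.isEmbedding φ.continuous (half_pos hε)
  have hφ'c : Continuous φ' := by
    let : MetricSpace M := hι.isEmbedding.comapMetricSpace ι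
    refine (LipschitzWith.of_dist_le_mul (K := ⟨Λ, hΛ0⟩) fun x y => ?_).continuous
    exact (hΛ x y).trans_eq (congrArg (Λ * ·) (dist_eq_norm (ι x) (ι y)).symm)
  set χ : C(M, ℝ) := ⟨φ', hφ'c⟩ with hχ
  have hV := isViscositySolution_value hP hι χ
  obtain ⟨Θ, -, hΘ⟩ := exists_lipschitz_value_space hP hι χ.exists_forall_abs_le ⟨Λ, hΛ0, hΛ⟩ (t + 2)
  have hΘ' : ∀ c : ℝ, ∀ s ∈ Icc 0 (t + 2), ∀ x y,
      |(P.value ι χ s x + c) - (P.value ι χ s y + c)| ≤ Θ * ‖ι x - ι y‖ := fun c s hs x y => by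
    rw [add_sub_add_right_eq_sub]; exact hΘ s hs x y
  have hlow := hV.add_const (-(ε / 2))
  have hupp := hV.add_const (ε / 2)
  have h1 := comparison (A := fun t x => P.value ι χ t x + -(ε / 2)) hP hι hlow.continuousOn hW.continuousOn hlow.subsolution hW.supersolution
    (fun x => by
      rw [hlow.initial, hW.initial]
      have := neg_le_of_abs_le (hφ' x)
      change φ' x + _ ≤ _
      linarith) ht (.inl (hΘ' _)) x
  have h2 := comparison (B := fun t x => P.value ι χ t x + ε / 2) hP hι hW.continuousOn hupp.continuousOn hW.subsolution hupp.supersolution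
    (fun x => by
      rw [hupp.initial, hW.initial]
      have := le_of_abs_le (hφ' x)
      change _ ≤ φ' x + _
      linarith) ht (.inr (hΘ' _)) x
  have h3 := value_le_value_add hP hι φ.exists_forall_abs_le (φ' := χ) (ε := ε / 2)
    (fun x => by have := le_of_abs_le (hφ' x); change _ ≤ φ' x + _; linarith) ht x
  have h4 := value_le_value_add hP hι χ.exists_forall_abs_le (φ' := φ) (ε := ε / 2)
    (fun x => by have := neg_le_of_abs_le (hφ' x); change φ' x ≤ _; linarith) ht x
  rw [Real.dist_eq]
  exact abs_sub_le_iff.2 ⟨by linarith, by linarith⟩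

omit [CompactSpace M] [IsManifold 𝓘(ℝ, EuclideanSpace ℝ (Fin n)) ∞ M] hP hι in
-- The admissible pairs and their costs coincide. Costs are compared only at times in `[0, t]` and
-- controls in `U`, where independence of time is assumed.
theorem value_shift_eq (h : ∀ t : ℝ, 0 ≤ t → ∀ x, ∀ u ∈ P.U, P.L t x u = P.L 0 x u) {s t : ℝ}
    (hs : 0 ≤ s) (ht : 0 ≤ t) (φ : M → ℝ) : (P.shift s).value ι φ t = P.value ι φ t := by
  have hL : ∀ r ∈ Icc 0 t, ∀ y, ∀ u ∈ P.U, P.L (s + r) y u = P.L r y u := fun r hr y u hu => by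
    rw [h _ (add_nonneg hs hr.1) y u hu, h r hr.1 y u hu]
  ext x
  unfold value
  congr 1
  ext c
  refine exists_congr fun u => exists_congr fun γ => ?_
  have key : (∀ y, ∀ r ∈ Icc 0 t, u y r ∈ P.U) →
      (∀ r ∈ Icc 0 t, (P.shift s).L r (γ r) (u (γ r) r) = P.L r (γ r) (u (γ r) r)) :=
    fun hu r hr => hL r hr _ _ (hu _ r hr)
  have hcost : (∀ y, ∀ r ∈ Icc 0 t, u y r ∈ P.U) →
      (P.shift s).cost φ t u γ = P.cost φ t u γ := fun hu => by
    unfold cost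
    congr 1
    refine intervalIntegral.integral_congr fun r hr => ?_
    rw [uIcc_of_le ht] at hr
    exact key hu r hr
  constructor
  · rintro ⟨h1, rfl⟩
    exact ⟨⟨h1.mem_U, h1.endpoint, h1.absolutelyContinuous, h1.measurable_control, h1.equation,
      h1.integrable_cost.congr_fun (key h1.mem_U) measurableSet_Icc⟩, hcost h1.mem_U⟩
  · rintro ⟨h1, rfl⟩
    exact ⟨⟨h1.mem_U, h1.endpoint, h1.absolutelyContinuous, h1.measurable_control, h1.equation,
      h1.integrable_cost.congr_fun (fun r hr => (key h1.mem_U r hr).symm) measurableSet_Icc⟩,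
      (hcost h1.mem_U).symm⟩

end
end ControlProblem

theorem mainTheorem3 {n m N : ℕ} {M : Type*} [TopologicalSpace M] [CompactSpace M]
    [ChartedSpace (EuclideanSpace ℝ (Fin n)) M]
    [IsManifold 𝓘(ℝ, EuclideanSpace ℝ (Fin n)) ∞ M]
    (ι : M → EuclideanSpace ℝ (Fin N))
    (hι : Manifold.IsSmoothEmbedding 𝓘(ℝ, EuclideanSpace ℝ (Fin n))
      𝓘(ℝ, EuclideanSpace ℝ (Fin N)) ∞ ι)
    (P : ControlProblem n m M) (hP : P.Regular ι) :
    -- the value function is the unique viscosity solution of the Cauchy problem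
    (∀ φ : C(M, ℝ), P.IsViscositySolution φ (P.value ι φ) ∧
      ∀ W : ℝ → M → ℝ, P.IsViscositySolution φ W →
        ∀ t : ℝ, 0 ≤ t → ∀ x, W t x = P.value ι φ t x) ∧
    -- composition law for a running cost that may depend on time
    (∀ φ : C(M, ℝ), ∀ s t : ℝ, 0 ≤ s → 0 ≤ t →
      P.value ι φ (t + s) = (P.shift s).value ι (P.value ι φ s) t) ∧
    -- semigroup on `C(M, ℝ)` when the running cost (hence the Hamiltonian) is time-independent
    ((∀ t : ℝ, 0 ≤ t → ∀ x, ∀ u ∈ P.U, P.L t x u = P.L 0 x u) →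
      ∃ T : ℝ≥0 → C(M, ℝ) → C(M, ℝ),
        (∀ t φ x, T t φ x = P.value ι φ t x) ∧
        T 0 = id ∧
        ∀ s t, T (t + s) = T t ∘ T s) := by
  refine ⟨fun φ => ⟨ControlProblem.isViscositySolution_value hP hι φ, fun W hW t ht x =>
      hW.eq_value hP hι ht x⟩,
    fun φ s t hs ht => ControlProblem.value_add hP hι φ.exists_forall_abs_le hs ht, fun hL => ?_⟩
  have hc : ∀ (t : ℝ≥0) (φ : C(M, ℝ)), Continuous (P.value ι φ t) := fun t φ =>
    (ControlProblem.continuousOn_value hP hι φ).comp_continuous (f := fun x => ((t : ℝ), x))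
      (by fun_prop) fun x => ⟨t.coe_nonneg, mem_univ _⟩
  refine ⟨fun t φ => ⟨P.value ι φ t, hc t φ⟩, fun _ _ _ => rfl, ?_, fun s t => ?_⟩
  · ext φ x
    exact congrFun (ControlProblem.value_zero hP hι φ φ.exists_forall_abs_le) x
  · ext φ x
    change P.value ι φ ((t + s : ℝ≥0) : ℝ) x = P.value ι (P.value ι φ s) t x
    rw [NNReal.coe_add, ControlProblem.value_add hP hι φ.exists_forall_abs_le
      s.coe_nonneg t.coe_nonneg,
      ControlProblem.value_shift_eq hL s.coe_nonneg t.coe_nonneg]
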